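/- **Setting.** Let $F_n(h,\tilde h,c)$ denote the coefficients of the four-point Virasoro conformal block $\mathcal F(h,\tilde h,c\,|\,z)=\sum_{n\ge 0}F_n(h,\tilde h,c)z^n$ with central charge $c$, four equal external dimensions $h$ and intermediate dimension $\tilde h$: $$F_n=\sum_{\mu,\nu\vdash n}\gamma_\mu\,(G_n^{-1})_{\mu\nu}\,\gamma_\nu ,$$ where $G_n$ is the Gram matrix of the contravariant form on the level-$n$ vectors $L_{-k_1}\cdots L_{-k_r}|\tilde h\rangle$ ($k_1\ge\dots\ge k_r\ge1$, $\sum k_i=n$) of the Virasoro Verma module, and $\gamma_{(k_1,\dots,k_r)}=\prod_{i}\bigl(\tilde h+k_ih-h+\sum_{j>i}k_j\bigr)$. For $\alpha\in(0,1)\cap\mathbb Q$ and real $\delta,\tilde\delta$ with $\tilde\delta\ne0$ put $h=\delta c^\alpha$, $\tilde h=\tilde\delta c^\alpha$, and expand each coefficient of $z^n$, $n\le 5$, of the logarithmic block $f^{(\alpha)}=\log\mathcal F$ in a (formal) Puiseux series near $c=\infty$; let $f^{(\alpha)}_a=f^{(\alpha)}_a(\delta,\tilde\delta|z)$ be the coefficient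 of $c^a$. The principal part $\mathrm{Prin}\,f^{(\alpha)}$ consists of the terms with powers $a\ge0$ of $c$ (the $c^0$ term is included). All identities and non-identities below are between functions of $(\delta,\tilde\delta)$, $\tilde\delta\neq0$, with values in power series in $z$ taken up to $O(z^6)$. **Proposition.** Let $M\ge1$ be an integer and $\alpha\in\bigl(\frac{M-1}{M},\frac{M}{M+1}\bigr]\cap\mathbb Q$. 1. $$\mathrm{Prin}\,f^{(\alpha)}=\sum_{m=1}^{M}f^{(\alpha)}_{m\alpha-m+1}\,c^{m\alpha-m+1}+f^{(\alpha)}_0 ,$$ and none of the $M+1$ coefficient functions $f^{(\alpha)}_{\alpha},f^{(\alpha)}_{2\alpha-1},\dots,f^{(\alpha)}_{M\alpha-(M-1)},f^{(\alpha)}_0$ vanishes identically. 2. (a) If also $\alpha'\in\bigl(\frac{M'-1}{M'},\frac{M'}{M'+1}\bigr]\cap\mathbb Q$ with an integer $M'\ge1$, then $f^{(\alpha)}_{m\alpha-m+1}=f^{(\alpha')}_{m\alpha'-m+1}$ for all $1\le m\le\min(M,M')$. (b) $f^{(\alpha)}_0$ is one and the same function for all regular $\alpha$, i.e. for all $\alpha\in(0,1)\cap\mathbb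 Q$ not of the form $\frac{N}{N+1}$, $N\geq 1$. (c) At the exceptional points $\tilde\alpha_N=\frac{N}{N+1}$, $N\ge1$, the functions $f_0^{(\tilde\alpha_N)}$ are pairwise different, and each of them differs from the function in (b). -/

import Mathlib

noncomputable section

namespace VirasoroBlock

section Block

variable {K : Type*} [Field K]

/-- The mode `L_n` (`n : ℤ`) of the Virasoro algebra with central charge `c`, acting on descendants
of a highest-weight vector `|h⟩` of dimension `h`. The list `[k₁, …, k_r]` (of positive integers)
stands for the descendant `L_{-k₁} ⋯ L_{-k_r} |h⟩`. A lowering index `n < 0` prepends a letter; for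
`n ≥ 0` the mode is commuted to the right with
`[L_n, L_{-k}] = (n + k) L_{n-k} + (c / 12) (n³ - n) δ_{n,k}`, and finally `L_0 |h⟩ = h |h⟩`,
`L_n |h⟩ = 0` for `n > 0`. -/
def mode (c h : K) (n : ℤ) : List ℕ → (List ℕ →₀ K)
  | [] =>
    if n < 0 then Finsupp.single [n.natAbs] 1
    else if n = 0 then Finsupp.single [] h
    else 0
  | k :: ks =>
    if n < 0 then Finsupp.single (n.natAbs :: k :: ks) 1
    else (mode c h n ks).mapDomain (fun w => k :: w)
      + ((n + k : ℤ) : K) • mode c h (n - k) ks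
      + (if n = k then Finsupp.single ks (c / 12 * ((n ^ 3 - n : ℤ) : K)) else 0)

/-- The linear extension of `mode` to combinations of descendants. -/
def modeLin (c h : K) (n : ℤ) (v : List ℕ →₀ K) : List ℕ →₀ K :=
  v.sum fun w x => x • mode c h n w

/-- The pairing of `L_{-k₁} ⋯ L_{-k_r} |h⟩` with `v` under the contravariant (Shapovalov) form,
`⟨h| L_{k_r} ⋯ L_{k₁} v`, normalized by `⟨h|h⟩ = 1`. -/
def shapovalov (c h : K) : List ℕ → (List ℕ →₀ K) → K
  | [], v => v []
  | k :: ks, v => shapovalov c h ks (modeLin c h k v)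

/-- The word `k₁ ≥ k₂ ≥ ⋯ ≥ k_r` of a partition. -/
def word {n : ℕ} (μ : n.Partition) : List ℕ :=
  μ.parts.sort (fun a b => a ≥ b)

/-- The Gram matrix of the level-`n` subspace of the Verma module of dimension `h`,
in the basis `L_{-k₁} ⋯ L_{-k_r} |h⟩`, `k₁ ≥ ⋯ ≥ k_r ≥ 1`, `∑ kᵢ = n`. -/
def gram (c h : K) (n : ℕ) : Matrix n.Partition n.Partition K :=
  fun μ ν => shapovalov c h (word μ) (Finsupp.single (word ν) 1)

/-- The three-point function of two primary operators of equal dimension `h` with the descendant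
`L_{-k₁} ⋯ L_{-k_r} |h'⟩` of a primary of dimension `h'`, relative to the three-point function of
the primaries. The Ward identity gives the factor `w + k h - h` for `L_{-k}` acting on a
descendant of weight `w`. -/
def vertex (h h' : K) : List ℕ → K
  | [] => 1
  | k :: ks => ((h' + (ks.sum : K)) + (k : K) * h - h) * vertex h h' ks

/-- The coefficient `F_n` of the four-point Virasoro block with four equal external dimensions `h`,
intermediate dimension `h'` and central charge `c`: the sum over the level-`n` descendants of
vertex, inverse Gram matrix, vertex. -/
def blockCoeff (c h h' : K) (n : ℕ) : K :=
  ∑ μ : n.Partition, ∑ ν : n.Partition,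
    vertex h h' (word μ) * (gram c h' n)⁻¹ μ ν * vertex h h' (word ν)

/-- The (bare) Virasoro block `∑ F_n z^n` as a formal power series in `z`. -/
def block (c h h' : K) : PowerSeries K :=
  PowerSeries.mk (blockCoeff c h h')

end Block

/-- Formal series in rational powers of the central charge near `c = ∞`. The exponent of the Hahn
series is the power of `1 / c`. -/
abbrev LargeC := HahnSeries ℚ ℝ

/-- The power `x c^a`, as a formal series near `c = ∞`. -/
def cMonomial (a : ℚ) (x : ℝ) : LargeC := HahnSeries.single (-a) x

/-- The coefficient of `c^a`. -/
def cCoeff (a : ℚ) (g : LargeC) : ℝ := g.coeff (-a)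

/-- The principal part: the terms with non-negative powers of `c` (including `c^0`). -/
def prin (g : LargeC) : LargeC where
  coeff := fun e => if e ≤ 0 then g.coeff e else 0
  isPWO_support' := g.isPWO_support.mono fun e he => by
    simp only [Function.mem_support, ne_eq, ite_eq_right_iff, Classical.not_imp] at he
    exact he.2

/-- Pairs `(δ, δ')` of classical dimensions, external and intermediate, with `δ' ≠ 0`. -/
abbrev ClassicalDims := ℝ × {x : ℝ // x ≠ 0}

/-- The logarithmic block `log F` for external dimensions `δ c^α` and intermediate dimension
`δ' c^α`, as a power series in `z` with coefficients in the series in powers of `c`. -/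
def logBlock (α : ℚ) (p : ClassicalDims) : PowerSeries LargeC :=
  PowerSeries.logOf (block (cMonomial 1 1) (cMonomial α p.1) (cMonomial α p.2))

/-- The principal part of the logarithmic block, up to `O(z^6)`. -/
def prinLogBlock (α : ℚ) (p : ClassicalDims) : Polynomial LargeC :=
  PowerSeries.trunc 6 (PowerSeries.mk fun n => prin (PowerSeries.coeff n (logBlock α p)))

/-- The coefficient of `c^a` in the logarithmic block, a function of the classical dimensions with
values in power series in `z` up to `O(z^6)`. -/
def f (α a : ℚ) (p : ClassicalDims) : Polynomial ℝ :=
  PowerSeries.trunc 6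
    (PowerSeries.mk fun n => cCoeff a (PowerSeries.coeff n (logBlock α p)))

/-- The exponent `m α - m + 1`. -/
def expo (m : ℕ) (α : ℚ) : ℚ := m * α - m + 1

/-- The half-open interval `((M - 1) / M, M / (M + 1)]` of rational numbers. -/
def halfOpen (M : ℕ) : Set ℚ := Set.Ioc (((M : ℚ) - 1) / M) ((M : ℚ) / (M + 1))

/-- The open interval `((M - 1) / M, M / (M + 1))` of rational numbers (regular points). -/
def regular (M : ℕ) : Set ℚ := Set.Ioo (((M : ℚ) - 1) / M) ((M : ℚ) / (M + 1))

/-- The exceptional point `M / (M + 1)`. -/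
def exceptional (M : ℕ) : ℚ := (M : ℚ) / (M + 1)

end VirasoroBlock

end

/-! Put `v = c^{-α}` and `s = c^{α-1}`, so that `c = (v s)⁻¹`, `h = δ / v` and `h̃ = δ' / v`. The
whole statement follows from one fact: for `n ≤ 5`, `v` times the `z^n` coefficient of `log F` is a
rational function of `v` and `s`, independent of `α`, whose denominator does not vanish at `v = s =
0` (`exists_hasLimit`). Its expansion is `∑ a_k s^k + b v` plus monomials divisible by `v s` or
`v²`. Those are smaller than `v`, because `0 < α < 1`. Dividing by `v` leaves `∑ a_k c^{α + k(α-1)}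
+ b + o(1)`, with `a` and `b` the same for every `α`.

The exponent `α + k(α-1)` is `expo (k+1) α`, and on `halfOpen M` it is positive exactly for `k + 1 ≤
M`. This gives the shape of the principal part and the universality of its coefficients. The `c^0`
term is `b`, except when some `expo (k+1) α` is zero, that is at `α = k/(k+1)`. There `s^k = v`, and
the term becomes `a_k + b`.

Regularity at `v = s = 0` is the exponentiation of the block. Changing basis from the ordered
monomials to quasi-primaries and their `L_{-1}`-descendants makes the Gram matrix block diagonal, so
the `F_n` have short closed forms in `ampTwo` and `ampFour`. Each of these may have a pole in `v`,
of order one and two respectively. In the logarithm only `ampTwo` and `ampFour - ampTwo² / 2` occur,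
and the double pole cancels in the latter (`ampFour_sub_scaled`): to leading order the second
level-4 quasi-primary is the square of the level-2 one.

All non-identities are read off from one sample, the `z²` coefficient at `δ = 0`, `δ' = 1`. There
the series `a` is `3/16 + X / (8 + 64 X)` and `b = 1/32` (`expands_unitDims`). So `a_0 = 3/16` and
`a_{k+1} = (-8)^k / 8`, which are nonzero, and the latter are pairwise distinct. -/

noncomputable section

namespace VirasoroBlock

/-! ### Recursive evaluation of the contravariant form -/

section Pairing

variable {K : Type*} [Field K]

/-- The value of a linear functional, given by its values `φ` on words, on `L_n` applied to a
descendant. -/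
def modeDual (c h : K) (φ : List ℕ → K) (n : ℤ) (w : List ℕ) : K :=
  (mode c h n w).sum fun u x => x * φ u

theorem modeDual_nil_neg (c h : K) (φ : List ℕ → K) {n : ℤ} (hn : n < 0) :
    modeDual c h φ n [] = φ [n.natAbs] := by
  simp [modeDual, mode, hn]

theorem modeDual_nil_pos (c h : K) (φ : List ℕ → K) {n : ℤ} (hn : 0 < n) :
    modeDual c h φ n [] = 0 := by
  simp [modeDual, mode, hn.not_gt, hn.ne']

theorem modeDual_cons_neg (c h : K) (φ : List ℕ → K) {n : ℤ} (hn : n < 0) (k : ℕ) (w : List ℕ) :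
    modeDual c h φ n (k :: w) = φ (n.natAbs :: k :: w) := by
  simp [modeDual, mode, hn]

theorem sum_add_mul (φ : List ℕ → K) (u v : List ℕ →₀ K) :
    ((u + v).sum fun w x => x * φ w) = (u.sum fun w x => x * φ w) + v.sum fun w x => x * φ w := by
  classical
  exact Finsupp.sum_add_index' (by simp) (by simp [add_mul])

theorem sum_smul_mul (φ : List ℕ → K) (a : K) (u : List ℕ →₀ K) :
    ((a • u).sum fun w x => x * φ w) = a * u.sum fun w x => x * φ w := by
  rw [Finsupp.sum_smul_index' (by simp), Finsupp.mul_sum]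
  simp [mul_assoc]

theorem modeDual_cons (c h : K) (φ : List ℕ → K) {n : ℤ} (hn : 0 ≤ n) (k : ℕ) (w : List ℕ) :
    modeDual c h φ n (k :: w) = modeDual c h (fun u => φ (k :: u)) n w
      + ((n + k : ℤ) : K) * modeDual c h φ (n - k) w
      + if n = k then c / 12 * ((n ^ 3 - n : ℤ) : K) * φ w else 0 := by
  rw [modeDual, mode, if_neg hn.not_gt, sum_add_mul, sum_add_mul, sum_smul_mul,
    Finsupp.sum_mapDomain_index (by simp) (by simp [add_mul])]
  split_ifs
  · rw [Finsupp.sum_single_index (zero_mul _)]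
    rfl
  · rw [Finsupp.sum_zero_index]
    rfl

/-- `L_0` acts by the weight. Positivity of the letters makes `0 - k` a lowering index, so the
commutator with `L_{-k}` restores the same word with coefficient `k`. -/
theorem modeDual_zero (c h : K) (φ : List ℕ → K) (w : List ℕ) (hw : ∀ k ∈ w, 0 < k) :
    modeDual c h φ 0 w = (h + (w.sum : ℕ)) * φ w := by
  induction w generalizing φ with
  | nil => simp [modeDual, mode]
  | cons k w ih =>
    have hk : 0 < k := hw k (by simp)
    have h1 : modeDual c h φ (0 - k) w = φ (k :: w) := by
      cases w with
      | nil => rw [modeDual_nil_neg _ _ _ (by omega)]; simp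
      | cons l w => rw [modeDual_cons_neg _ _ _ (by omega)]; simp
    rw [modeDual_cons _ _ _ le_rfl, h1, ih _ fun l hl => hw l (by simp [hl]),
      if_neg (by omega)]
    push_cast [List.sum_cons]
    ring

/-- The contravariant form on two descendants. -/
def pairing (c h : K) (u w : List ℕ) : K := shapovalov c h u (Finsupp.single w 1)

/-- The form is linear in its second argument, so it is determined by its values on words. This
turns `modeDual` into a recursion that removes one bra letter at a time. -/
theorem shapovalov_eq_sum (c h : K) (u : List ℕ) (v : List ℕ →₀ K) :
    shapovalov c h u v = v.sum fun w x => x * pairing c h u w := by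
  classical
  induction u generalizing v with
  | nil => simp [pairing, shapovalov, Finsupp.single_apply, Finsupp.sum_ite_eq']
  | cons k u ih =>
    have hlin : ∀ w, pairing c h (k :: u) w
        = (mode c h k w).sum fun w x => x * pairing c h u w := by
      intro w
      rw [pairing, shapovalov, ih]
      simp [modeLin]
    rw [shapovalov, ih, modeLin, Finsupp.sum_sum_index (by simp) (by simp [add_mul])]
    refine Finsupp.sum_congr fun w _ => ?_
    rw [sum_smul_mul, hlin]

theorem pairing_nil (c h : K) (w : List ℕ) : pairing c h [] w = if w = [] then 1 else 0 := by
  classical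
  simp [pairing, shapovalov, Finsupp.single_apply]

theorem pairing_cons (c h : K) (k : ℕ) (u w : List ℕ) :
    pairing c h (k :: u) w = modeDual c h (pairing c h u) k w := by
  rw [pairing, shapovalov, shapovalov_eq_sum, modeDual]
  simp [modeLin]

end Pairing

/-! ### Explicit Gram matrices at levels 1 to 5 -/

section GramTables

variable {K : Type*} [Field K]

set_option linter.unusedSimpArgs false

theorem pairing_one (c H : K) : pairing c H [1] [1] = 2 * H := by
  simp [pairing_cons, pairing_nil, modeDual_cons, modeDual_zero, modeDual_nil_pos]

theorem pairing_one_one [CharZero K] (c H : K) :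
    pairing c H [1, 1] [1, 1] = 8 * H ^ 2 + 4 * H ∧
    pairing c H [1, 1] [2] = 6 * H := by
  refine ⟨?_, ?_⟩ <;>
    simp only [pairing_cons] <;>
    simp [pairing_one, modeDual_cons, modeDual_zero, modeDual_nil_neg, modeDual_nil_pos,
      modeDual_cons_neg] <;> try ring

theorem pairing_two [CharZero K] (c H : K) :
    pairing c H [2] [1, 1] = 6 * H ∧
    pairing c H [2] [2] = 1 / 2 * c + 4 * H := by
  refine ⟨?_, ?_⟩ <;>
    simp only [pairing_cons] <;>
    simp [pairing_nil, modeDual_cons, modeDual_zero, modeDual_nil_neg, modeDual_nil_pos,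
      modeDual_cons_neg] <;> try ring

/-- Each table strips the first bra letter, commutes that mode through the ket and uses the table of
the remaining bra. Commuting `L_1` through `L_{-2} L_{-2}` leaves `L_{-1} L_{-2}`, so some kets that
are not weakly decreasing must also be tabulated. -/
theorem pairing_one_one_one [CharZero K] (c H : K) :
    pairing c H [1, 1, 1] [1, 1, 1] = 48 * H ^ 3 + 72 * H ^ 2 + 24 * H ∧
    pairing c H [1, 1, 1] [1, 2] = 36 * H ^ 2 + 36 * H ∧
    pairing c H [1, 1, 1] [2, 1] = 36 * H ^ 2 + 12 * H ∧
    pairing c H [1, 1, 1] [3] = 24 * H := by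
  refine ⟨?_, ?_, ?_, ?_⟩ <;>
    simp only [pairing_cons] <;>
    simp [pairing_one_one, modeDual_cons, modeDual_zero, modeDual_nil_neg, modeDual_nil_pos,
      modeDual_cons_neg] <;> try ring

theorem pairing_two_one [CharZero K] (c H : K) :
    pairing c H [2, 1] [1, 1, 1] = 36 * H ^ 2 + 12 * H ∧
    pairing c H [2, 1] [1, 2] = c * H + 8 * H ^ 2 + 18 * H ∧
    pairing c H [2, 1] [2, 1] = c * H + 8 * H ^ 2 + 8 * H ∧
    pairing c H [2, 1] [3] = 10 * H := by
  refine ⟨?_, ?_, ?_, ?_⟩ <;>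
    simp only [pairing_cons] <;>
    simp [pairing_one, modeDual_cons, modeDual_zero, modeDual_nil_neg, modeDual_nil_pos,
      modeDual_cons_neg] <;> try ring

theorem pairing_three [CharZero K] (c H : K) :
    pairing c H [3] [1, 1, 1] = 24 * H ∧
    pairing c H [3] [2, 1] = 10 * H ∧
    pairing c H [3] [3] = 2 * c + 6 * H := by
  refine ⟨?_, ?_, ?_⟩ <;>
    simp only [pairing_cons] <;>
    simp [pairing_nil, modeDual_cons, modeDual_zero, modeDual_nil_neg, modeDual_nil_pos,
      modeDual_cons_neg] <;> try ring

theorem pairing_one_one_one_one [CharZero K] (c H : K) :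
    pairing c H [1, 1, 1, 1] [1, 1, 1, 1] = 384 * H ^ 4 + 1152 * H ^ 3 + 1056 * H ^ 2 + 288 * H ∧
    pairing c H [1, 1, 1, 1] [1, 2, 1] = 288 * H ^ 3 + 528 * H ^ 2 + 144 * H ∧
    pairing c H [1, 1, 1, 1] [2, 1, 1] = 288 * H ^ 3 + 336 * H ^ 2 + 96 * H ∧
    pairing c H [1, 1, 1, 1] [2, 2] = 216 * H ^ 2 + 144 * H ∧
    pairing c H [1, 1, 1, 1] [3, 1] = 192 * H ^ 2 + 48 * H ∧
    pairing c H [1, 1, 1, 1] [4] = 120 * H := by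
  refine ⟨?_, ?_, ?_, ?_, ?_, ?_⟩ <;>
    simp only [pairing_cons] <;>
    simp [pairing_one_one_one, modeDual_cons, modeDual_zero, modeDual_nil_neg, modeDual_nil_pos,
      modeDual_cons_neg] <;> try ring

theorem pairing_two_one_one [CharZero K] (c H : K) :
    pairing c H [2, 1, 1] [1, 1, 1, 1] = 288 * H ^ 3 + 336 * H ^ 2 + 96 * H ∧
    pairing c H [2, 1, 1] [2, 1, 1] = 4 * c * H ^ 2 + 2 * c * H + 32 * H ^ 3 + 116 * H ^ 2
      + 32 * H ∧
    pairing c H [2, 1, 1] [2, 2] = 6 * c * H + 48 * H ^ 2 + 48 * H ∧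
    pairing c H [2, 1, 1] [3, 1] = 40 * H ^ 2 + 20 * H ∧
    pairing c H [2, 1, 1] [4] = 36 * H := by
  refine ⟨?_, ?_, ?_, ?_, ?_⟩ <;>
    simp only [pairing_cons] <;>
    simp [pairing_one_one, modeDual_cons, modeDual_zero, modeDual_nil_neg, modeDual_nil_pos,
      modeDual_cons_neg] <;> try ring

theorem pairing_two_two [CharZero K] (c H : K) :
    pairing c H [2, 2] [1, 1, 1, 1] = 216 * H ^ 2 + 144 * H ∧
    pairing c H [2, 2] [2, 1, 1] = 6 * c * H + 48 * H ^ 2 + 48 * H ∧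
    pairing c H [2, 2] [2, 2] = 1 / 2 * c ^ 2 + 8 * c * H + 4 * c + 32 * H ^ 2 + 32 * H ∧
    pairing c H [2, 2] [3, 1] = 30 * H ∧
    pairing c H [2, 2] [4] = 3 * c + 24 * H := by
  refine ⟨?_, ?_, ?_, ?_, ?_⟩ <;>
    simp only [pairing_cons] <;>
    simp [pairing_two, modeDual_cons, modeDual_zero, modeDual_nil_neg, modeDual_nil_pos,
      modeDual_cons_neg] <;> try ring

theorem pairing_three_one [CharZero K] (c H : K) :
    pairing c H [3, 1] [1, 1, 1, 1] = 192 * H ^ 2 + 48 * H ∧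
    pairing c H [3, 1] [2, 1, 1] = 40 * H ^ 2 + 20 * H ∧
    pairing c H [3, 1] [2, 2] = 30 * H ∧
    pairing c H [3, 1] [3, 1] = 4 * c * H + 12 * H ^ 2 + 12 * H ∧
    pairing c H [3, 1] [4] = 14 * H := by
  refine ⟨?_, ?_, ?_, ?_, ?_⟩ <;>
    simp only [pairing_cons] <;>
    simp [pairing_one, modeDual_cons, modeDual_zero, modeDual_nil_neg, modeDual_nil_pos,
      modeDual_cons_neg] <;> try ring

theorem pairing_four [CharZero K] (c H : K) :
    pairing c H [4] [1, 1, 1, 1] = 120 * H ∧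
    pairing c H [4] [2, 1, 1] = 36 * H ∧
    pairing c H [4] [2, 2] = 3 * c + 24 * H ∧
    pairing c H [4] [3, 1] = 14 * H ∧
    pairing c H [4] [4] = 5 * c + 8 * H := by
  refine ⟨?_, ?_, ?_, ?_, ?_⟩ <;>
    simp only [pairing_cons] <;>
    simp [pairing_nil, modeDual_cons, modeDual_zero, modeDual_nil_neg, modeDual_nil_pos,
      modeDual_cons_neg] <;> try ring

theorem pairing_one_one_one_one_one [CharZero K] (c H : K) :
    pairing c H [1, 1, 1, 1, 1] [1, 1, 1, 1, 1] = 3840 * H ^ 5 + 19200 * H ^ 4 + 33600 * H ^ 3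
      + 24000 * H ^ 2 + 5760 * H ∧
    pairing c H [1, 1, 1, 1, 1] [2, 1, 1, 1] = 2880 * H ^ 4 + 7200 * H ^ 3 + 5760 * H ^ 2
      + 1440 * H ∧
    pairing c H [1, 1, 1, 1, 1] [2, 2, 1] = 2160 * H ^ 3 + 2880 * H ^ 2 + 720 * H ∧
    pairing c H [1, 1, 1, 1, 1] [3, 1, 1] = 1920 * H ^ 3 + 1920 * H ^ 2 + 480 * H ∧
    pairing c H [1, 1, 1, 1, 1] [3, 2] = 1440 * H ^ 2 + 720 * H ∧
    pairing c H [1, 1, 1, 1, 1] [4, 1] = 1200 * H ^ 2 + 240 * H ∧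
    pairing c H [1, 1, 1, 1, 1] [5] = 720 * H := by
  refine ⟨?_, ?_, ?_, ?_, ?_, ?_, ?_⟩ <;>
    simp only [pairing_cons] <;>
    simp [pairing_one_one_one_one, modeDual_cons, modeDual_zero, modeDual_nil_neg,
      modeDual_nil_pos,
      modeDual_cons_neg] <;> try ring

theorem pairing_two_one_one_one [CharZero K] (c H : K) :
    pairing c H [2, 1, 1, 1] [1, 1, 1, 1, 1] = 2880 * H ^ 4 + 7200 * H ^ 3 + 5760 * H ^ 2
      + 1440 * H ∧
    pairing c H [2, 1, 1, 1] [2, 1, 1, 1] = 24 * c * H ^ 3 + 36 * c * H ^ 2 + 12 * c * H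
      + 192 * H ^ 4 + 1512 * H ^ 3 + 1392 * H ^ 2 + 360 * H ∧
    pairing c H [2, 1, 1, 1] [2, 2, 1] = 36 * c * H ^ 2 + 12 * c * H + 288 * H ^ 3 + 672 * H ^ 2
      + 192 * H ∧
    pairing c H [2, 1, 1, 1] [3, 1, 1] = 240 * H ^ 3 + 504 * H ^ 2 + 120 * H ∧
    pairing c H [2, 1, 1, 1] [3, 2] = 12 * c * H + 276 * H ^ 2 + 180 * H ∧
    pairing c H [2, 1, 1, 1] [4, 1] = 216 * H ^ 2 + 72 * H ∧
    pairing c H [2, 1, 1, 1] [5] = 168 * H := by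
  refine ⟨?_, ?_, ?_, ?_, ?_, ?_, ?_⟩ <;>
    simp only [pairing_cons] <;>
    simp [pairing_one_one_one, modeDual_cons, modeDual_zero, modeDual_nil_neg, modeDual_nil_pos,
      modeDual_cons_neg] <;> try ring

theorem pairing_two_two_one [CharZero K] (c H : K) :
    pairing c H [2, 2, 1] [1, 1, 1, 1, 1] = 2160 * H ^ 3 + 2880 * H ^ 2 + 720 * H ∧
    pairing c H [2, 2, 1] [2, 1, 1, 1] = 36 * c * H ^ 2 + 12 * c * H + 288 * H ^ 3 + 672 * H ^ 2
      + 192 * H ∧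
    pairing c H [2, 2, 1] [2, 2, 1] = c ^ 2 * H + 16 * c * H ^ 2 + 24 * c * H + 64 * H ^ 3
      + 192 * H ^ 2 + 128 * H ∧
    pairing c H [2, 2, 1] [3, 1, 1] = 240 * H ^ 2 + 60 * H ∧
    pairing c H [2, 2, 1] [3, 2] = 10 * c * H + 80 * H ^ 2 + 90 * H ∧
    pairing c H [2, 2, 1] [4, 1] = 6 * c * H + 48 * H ^ 2 + 48 * H ∧
    pairing c H [2, 2, 1] [5] = 70 * H := by
  refine ⟨?_, ?_, ?_, ?_, ?_, ?_, ?_⟩ <;>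
    simp only [pairing_cons] <;>
    simp [pairing_two_one, modeDual_cons, modeDual_zero, modeDual_nil_neg, modeDual_nil_pos,
      modeDual_cons_neg] <;> try ring

theorem pairing_three_one_one [CharZero K] (c H : K) :
    pairing c H [3, 1, 1] [1, 1, 1, 1, 1] = 1920 * H ^ 3 + 1920 * H ^ 2 + 480 * H ∧
    pairing c H [3, 1, 1] [2, 1, 1, 1] = 240 * H ^ 3 + 504 * H ^ 2 + 120 * H ∧
    pairing c H [3, 1, 1] [2, 2, 1] = 240 * H ^ 2 + 60 * H ∧
    pairing c H [3, 1, 1] [3, 1, 1] = 16 * c * H ^ 2 + 8 * c * H + 48 * H ^ 3 + 120 * H ^ 2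
      + 48 * H ∧
    pairing c H [3, 1, 1] [3, 2] = 12 * c * H + 36 * H ^ 2 + 72 * H ∧
    pairing c H [3, 1, 1] [4, 1] = 56 * H ^ 2 + 28 * H ∧
    pairing c H [3, 1, 1] [5] = 48 * H := by
  refine ⟨?_, ?_, ?_, ?_, ?_, ?_, ?_⟩ <;>
    simp only [pairing_cons] <;>
    simp [pairing_one_one, modeDual_cons, modeDual_zero, modeDual_nil_neg, modeDual_nil_pos,
      modeDual_cons_neg] <;> try ring

theorem pairing_three_two [CharZero K] (c H : K) :
    pairing c H [3, 2] [1, 1, 1, 1, 1] = 1440 * H ^ 2 + 720 * H ∧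
    pairing c H [3, 2] [2, 1, 1, 1] = 12 * c * H + 276 * H ^ 2 + 180 * H ∧
    pairing c H [3, 2] [2, 2, 1] = 10 * c * H + 80 * H ^ 2 + 90 * H ∧
    pairing c H [3, 2] [3, 1, 1] = 12 * c * H + 36 * H ^ 2 + 72 * H ∧
    pairing c H [3, 2] [3, 2] = c ^ 2 + 11 * c * H + 6 * c + 24 * H ^ 2 + 48 * H ∧
    pairing c H [3, 2] [4, 1] = 42 * H ∧
    pairing c H [3, 2] [5] = 4 * c + 32 * H := by
  refine ⟨?_, ?_, ?_, ?_, ?_, ?_, ?_⟩ <;>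
    simp only [pairing_cons] <;>
    simp [pairing_two, modeDual_cons, modeDual_zero, modeDual_nil_neg, modeDual_nil_pos,
      modeDual_cons_neg] <;> try ring

theorem pairing_four_one [CharZero K] (c H : K) :
    pairing c H [4, 1] [1, 1, 1, 1, 1] = 1200 * H ^ 2 + 240 * H ∧
    pairing c H [4, 1] [2, 1, 1, 1] = 216 * H ^ 2 + 72 * H ∧
    pairing c H [4, 1] [2, 2, 1] = 6 * c * H + 48 * H ^ 2 + 48 * H ∧
    pairing c H [4, 1] [3, 1, 1] = 56 * H ^ 2 + 28 * H ∧
    pairing c H [4, 1] [3, 2] = 42 * H ∧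
    pairing c H [4, 1] [4, 1] = 10 * c * H + 16 * H ^ 2 + 16 * H ∧
    pairing c H [4, 1] [5] = 18 * H := by
  refine ⟨?_, ?_, ?_, ?_, ?_, ?_, ?_⟩ <;>
    simp only [pairing_cons] <;>
    simp [pairing_one, modeDual_cons, modeDual_zero, modeDual_nil_neg, modeDual_nil_pos,
      modeDual_cons_neg] <;> try ring

theorem pairing_five [CharZero K] (c H : K) :
    pairing c H [5] [1, 1, 1, 1, 1] = 720 * H ∧
    pairing c H [5] [2, 1, 1, 1] = 168 * H ∧
    pairing c H [5] [2, 2, 1] = 70 * H ∧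
    pairing c H [5] [3, 1, 1] = 48 * H ∧
    pairing c H [5] [3, 2] = 4 * c + 32 * H ∧
    pairing c H [5] [4, 1] = 18 * H ∧
    pairing c H [5] [5] = 10 * c + 10 * H := by
  refine ⟨?_, ?_, ?_, ?_, ?_, ?_, ?_⟩ <;>
    simp only [pairing_cons] <;>
    simp [pairing_nil, modeDual_cons, modeDual_zero, modeDual_nil_neg, modeDual_nil_pos,
      modeDual_cons_neg] <;> try ring

/-- The partitions of `1`, as words. -/
def wordsOne : Fin 1 → List ℕ :=
  ![[1]]

/-- The Gram matrix at level `1`. -/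
def gramOne (H : K) : Matrix (Fin 1) (Fin 1) K :=
  !![2 * H]

theorem pairing_wordsOne (c H : K) (i j : Fin 1) :
    pairing c H (wordsOne i) (wordsOne j) = gramOne H i j := by
  fin_cases i
  fin_cases j
  simp [wordsOne, gramOne, pairing_one]

/-- The partitions of `2`, as words. -/
def wordsTwo : Fin 2 → List ℕ :=
  ![[1, 1], [2]]

/-- The Gram matrix at level `2`. -/
def gramTwo (c H : K) : Matrix (Fin 2) (Fin 2) K :=
  !![8 * H ^ 2 + 4 * H, 6 * H;
      6 * H, 1 / 2 * c + 4 * H]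

theorem pairing_wordsTwo [CharZero K] (c H : K) (i j : Fin 2) :
    pairing c H (wordsTwo i) (wordsTwo j) = gramTwo c H i j := by
  fin_cases i <;> fin_cases j <;>
    simp [wordsTwo, gramTwo, pairing_one_one, pairing_two]

/-- The partitions of `3`, as words. -/
def wordsThree : Fin 3 → List ℕ :=
  ![[1, 1, 1], [2, 1], [3]]

/-- The Gram matrix at level `3`. -/
def gramThree (c H : K) : Matrix (Fin 3) (Fin 3) K :=
  !![48 * H ^ 3 + 72 * H ^ 2 + 24 * H, 36 * H ^ 2 + 12 * H, 24 * H;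
      36 * H ^ 2 + 12 * H, c * H + 8 * H ^ 2 + 8 * H, 10 * H;
      24 * H, 10 * H, 2 * c + 6 * H]

theorem pairing_wordsThree [CharZero K] (c H : K) (i j : Fin 3) :
    pairing c H (wordsThree i) (wordsThree j) = gramThree c H i j := by
  fin_cases i <;> fin_cases j <;>
    simp [wordsThree, gramThree, pairing_one_one_one, pairing_two_one, pairing_three]

/-- The partitions of `4`, as words. -/
def wordsFour : Fin 5 → List ℕ :=
  ![[1, 1, 1, 1], [2, 1, 1], [2, 2], [3, 1], [4]]

/-- The Gram matrix at level `4`. -/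
def gramFour (c H : K) : Matrix (Fin 5) (Fin 5) K :=
  !![384 * H ^ 4 + 1152 * H ^ 3 + 1056 * H ^ 2 + 288 * H, 288 * H ^ 3 + 336 * H ^ 2 + 96 * H,
      216 * H ^ 2 + 144 * H, 192 * H ^ 2 + 48 * H, 120 * H;
      288 * H ^ 3 + 336 * H ^ 2 + 96 * H, 4 * c * H ^ 2 + 2 * c * H + 32 * H ^ 3 + 116 * H ^ 2
        + 32 * H, 6 * c * H + 48 * H ^ 2 + 48 * H, 40 * H ^ 2 + 20 * H, 36 * H;
      216 * H ^ 2 + 144 * H, 6 * c * H + 48 * H ^ 2 + 48 * H, 1 / 2 * c ^ 2 + 8 * c * H + 4 * c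
        + 32 * H ^ 2 + 32 * H, 30 * H, 3 * c + 24 * H;
      192 * H ^ 2 + 48 * H, 40 * H ^ 2 + 20 * H, 30 * H, 4 * c * H + 12 * H ^ 2 + 12 * H, 14 * H;
      120 * H, 36 * H, 3 * c + 24 * H, 14 * H, 5 * c + 8 * H]

theorem pairing_wordsFour [CharZero K] (c H : K) (i j : Fin 5) :
    pairing c H (wordsFour i) (wordsFour j) = gramFour c H i j := by
  fin_cases i <;> fin_cases j <;>
    simp [wordsFour, gramFour, pairing_one_one_one_one, pairing_two_one_one, pairing_two_two,
      pairing_three_one, pairing_four]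

/-- The partitions of `5`, as words. -/
def wordsFive : Fin 7 → List ℕ :=
  ![[1, 1, 1, 1, 1], [2, 1, 1, 1], [2, 2, 1], [3, 1, 1], [3, 2], [4, 1], [5]]

/-- The Gram matrix at level `5`. -/
def gramFive (c H : K) : Matrix (Fin 7) (Fin 7) K :=
  !![3840 * H ^ 5 + 19200 * H ^ 4 + 33600 * H ^ 3 + 24000 * H ^ 2 + 5760 * H, 2880 * H ^ 4
      + 7200 * H ^ 3 + 5760 * H ^ 2 + 1440 * H, 2160 * H ^ 3 + 2880 * H ^ 2 + 720 * H,
      1920 * H ^ 3 + 1920 * H ^ 2 + 480 * H, 1440 * H ^ 2 + 720 * H, 1200 * H ^ 2 + 240 * H,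
      720 * H;
      2880 * H ^ 4 + 7200 * H ^ 3 + 5760 * H ^ 2 + 1440 * H, 24 * c * H ^ 3 + 36 * c * H ^ 2
        + 12 * c * H + 192 * H ^ 4 + 1512 * H ^ 3 + 1392 * H ^ 2 + 360 * H, 36 * c * H ^ 2
        + 12 * c * H + 288 * H ^ 3 + 672 * H ^ 2 + 192 * H, 240 * H ^ 3 + 504 * H ^ 2 + 120 * H,
        12 * c * H + 276 * H ^ 2 + 180 * H, 216 * H ^ 2 + 72 * H, 168 * H;
      2160 * H ^ 3 + 2880 * H ^ 2 + 720 * H, 36 * c * H ^ 2 + 12 * c * H + 288 * H ^ 3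
        + 672 * H ^ 2 + 192 * H, c ^ 2 * H + 16 * c * H ^ 2 + 24 * c * H + 64 * H ^ 3
        + 192 * H ^ 2 + 128 * H, 240 * H ^ 2 + 60 * H, 10 * c * H + 80 * H ^ 2 + 90 * H, 6 * c * H
        + 48 * H ^ 2 + 48 * H, 70 * H;
      1920 * H ^ 3 + 1920 * H ^ 2 + 480 * H, 240 * H ^ 3 + 504 * H ^ 2 + 120 * H, 240 * H ^ 2
        + 60 * H, 16 * c * H ^ 2 + 8 * c * H + 48 * H ^ 3 + 120 * H ^ 2 + 48 * H, 12 * c * H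
        + 36 * H ^ 2 + 72 * H, 56 * H ^ 2 + 28 * H, 48 * H;
      1440 * H ^ 2 + 720 * H, 12 * c * H + 276 * H ^ 2 + 180 * H, 10 * c * H + 80 * H ^ 2
        + 90 * H, 12 * c * H + 36 * H ^ 2 + 72 * H, c ^ 2 + 11 * c * H + 6 * c + 24 * H ^ 2
        + 48 * H, 42 * H, 4 * c + 32 * H;
      1200 * H ^ 2 + 240 * H, 216 * H ^ 2 + 72 * H, 6 * c * H + 48 * H ^ 2 + 48 * H, 56 * H ^ 2
        + 28 * H, 42 * H, 10 * c * H + 16 * H ^ 2 + 16 * H, 18 * H;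
      720 * H, 168 * H, 70 * H, 48 * H, 4 * c + 32 * H, 18 * H, 10 * c + 10 * H]

theorem pairing_wordsFive [CharZero K] (c H : K) (i j : Fin 7) :
    pairing c H (wordsFive i) (wordsFive j) = gramFive c H i j := by
  fin_cases i <;> fin_cases j <;>
    simp [wordsFive, gramFive, pairing_one_one_one_one_one, pairing_two_one_one_one,
      pairing_two_two_one, pairing_three_one_one, pairing_three_two, pairing_four_one,
      pairing_five]

end GramTables

/-! ### Partitions as lists, and change of basis in the block sum -/

section Words

variable {K : Type*} [Field K]

/-- `W` lists the weakly decreasing words of positive integers with sum `n`, without repetition. -/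
structure Enumerates (n : ℕ) {ι : Type*} (W : ι → List ℕ) : Prop where
  injective : Function.Injective W
  sorted : ∀ i, (W i).Pairwise (· ≥ ·)
  pos : ∀ i, ∀ k ∈ W i, 0 < k
  sum_eq : ∀ i, (W i).sum = n
  exists_eq : ∀ w : List ℕ, w.Pairwise (· ≥ ·) → (∀ k ∈ w, 0 < k) → w.sum = n → ∃ i, W i = w

/-- A weakly decreasing list is determined by its multiset of entries, so the explicit words can
index the sum over partitions. -/
theorem Enumerates.exists_equiv {n : ℕ} {ι : Type*} {W : ι → List ℕ} (hW : Enumerates n W) :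
    ∃ e : ι ≃ n.Partition, ∀ i, word (e i) = W i := by
  let e : ι → n.Partition := fun i =>
    ⟨W i, fun hk => hW.pos i _ (by simpa using hk), by simpa using hW.sum_eq i⟩
  have he : ∀ i, word (e i) = W i := fun i =>
    List.Perm.eq_of_pairwise' (Multiset.pairwise_sort _ _) (hW.sorted i)
      (Multiset.coe_eq_coe.1 (Multiset.sort_eq _ _))
  refine ⟨Equiv.ofBijective e ⟨fun i j hij => hW.injective ?_, fun μ => ?_⟩, he⟩
  · rw [← he, ← he, hij]
  · obtain ⟨i, hi⟩ := hW.exists_eq (word μ) (Multiset.pairwise_sort _ _)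
      (fun k hk => μ.parts_pos ((Multiset.mem_sort _).1 hk))
      (by rw [← Multiset.sum_coe, word, Multiset.sort_eq, μ.parts_sum])
    refine ⟨i, Nat.Partition.ext ?_⟩
    rw [← Multiset.sort_eq μ.parts (fun a b => a ≥ b)]
    exact congrArg _ hi

theorem Enumerates.blockCoeff_eq {n : ℕ} {ι : Type*} [Fintype ι] [DecidableEq ι]
    {W : ι → List ℕ} (hW : Enumerates n W) (c h H : K) :
    blockCoeff c h H n = ∑ i, ∑ j, vertex h H (W i) *
      (Matrix.of fun i j => pairing c H (W i) (W j))⁻¹ i j * vertex h H (W j) := by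
  obtain ⟨e, he⟩ := hW.exists_equiv
  have hG : (Matrix.of fun i j => pairing c H (W i) (W j)) = (gram c H n).submatrix e e := by
    ext i j
    simp [gram, pairing, he]
  rw [hG, Matrix.inv_submatrix_equiv, blockCoeff, ← e.sum_comp]
  refine Finset.sum_congr rfl fun i _ => ?_
  rw [← e.sum_comp]
  simp [he]

/-- A congruence `B = P G Pᵀ` gives `G⁻¹ = Pᵀ B⁻¹ P`. Invertibility of `P` and of `G` need not be
checked separately: `B Y = 1` supplies a right inverse of `P`, which for square matrices is
two-sided. -/
theorem sum_inv_mul_eq {ι : Type*} [Fintype ι] [DecidableEq ι] {G P B Y : Matrix ι ι K}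
    (hB : P * G * P.transpose = B) (hY : B * Y = 1) (γ : ι → K) :
    ∑ i, ∑ j, γ i * G⁻¹ i j * γ j = ∑ i, ∑ j, P.mulVec γ i * Y i j * P.mulVec γ j := by
  have h1 : P * (G * P.transpose * Y) = 1 := by
    rw [← hY, ← hB]; simp only [Matrix.mul_assoc]
  have h2 : G * (P.transpose * Y * P) = 1 := by
    rw [← mul_eq_one_comm.1 h1]; simp only [Matrix.mul_assoc]
  rw [Matrix.inv_eq_right_inv h2]
  have key : ∀ (M : Matrix ι ι K) (x : ι → K),
      ∑ i, ∑ j, x i * M i j * x j = x ⬝ᵥ M.mulVec x := by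
    intro M x
    simp [dotProduct, Matrix.mulVec, Finset.mul_sum, mul_assoc]
  rw [key, key, ← Matrix.mulVec_mulVec, ← Matrix.mulVec_mulVec, Matrix.dotProduct_mulVec,
    Matrix.vecMul_transpose]

theorem blockCoeff_eq_of_diagonalization {n : ℕ} {ι : Type*} [Fintype ι] [DecidableEq ι]
    {W : ι → List ℕ} (hW : Enumerates n W) {c h H : K} {G P B Y : Matrix ι ι K}
    (hG : ∀ i j, pairing c H (W i) (W j) = G i j)
    (hB : P * G * P.transpose = B) (hY : B * Y = 1) {g : ι → K}
    (hg : P.mulVec (fun i => vertex h H (W i)) = g) :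
    blockCoeff c h H n = ∑ i, ∑ j, g i * Y i j * g j := by
  have : (Matrix.of fun i j => pairing c H (W i) (W j)) = G := by
    ext i j; exact hG i j
  rw [hW.blockCoeff_eq, this, sum_inv_mul_eq hB hY, hg]

theorem enumerates_wordsOne : Enumerates 1 wordsOne where
  injective := by decide
  sorted := by decide
  pos := by decide
  sum_eq := by decide
  exists_eq := by
    rintro (_ | ⟨a, _ | ⟨b, w⟩⟩) hs hp hsum <;> simp at hs hp hsum
    · subst hsum; exact ⟨0, rfl⟩
    · omega

theorem enumerates_wordsTwo : Enumerates 2 wordsTwo where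
  injective := by decide
  sorted := by decide
  pos := by decide
  sum_eq := by decide
  exists_eq := by
    rintro (_ | ⟨a, _ | ⟨b, _ | ⟨d, w⟩⟩⟩) hs hp hsum <;> simp at hs hp hsum
    · subst hsum; exact ⟨1, rfl⟩
    · obtain ⟨rfl, rfl⟩ : a = 1 ∧ b = 1 := by omega
      exact ⟨0, rfl⟩
    · omega

theorem enumerates_wordsThree : Enumerates 3 wordsThree where
  injective := by decide
  sorted := by decide
  pos := by decide
  sum_eq := by decide
  exists_eq := by
    rintro (_ | ⟨a, _ | ⟨b, _ | ⟨d, _ | ⟨e, w⟩⟩⟩⟩) hs hp hsum <;> simp at hs hp hsum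
    · subst hsum; exact ⟨2, rfl⟩
    · obtain ⟨rfl, rfl⟩ : a = 2 ∧ b = 1 := by omega
      exact ⟨1, rfl⟩
    · obtain ⟨rfl, rfl, rfl⟩ : a = 1 ∧ b = 1 ∧ d = 1 := by omega
      exact ⟨0, rfl⟩
    · omega

theorem enumerates_wordsFour : Enumerates 4 wordsFour where
  injective := by decide
  sorted := by decide
  pos := by decide
  sum_eq := by decide
  exists_eq := by
    rintro (_ | ⟨a, _ | ⟨b, _ | ⟨d, _ | ⟨e, _ | ⟨k, w⟩⟩⟩⟩⟩) hs hp hsum <;>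
      simp at hs hp hsum
    · subst hsum; exact ⟨4, rfl⟩
    · obtain ⟨rfl, rfl⟩ | ⟨rfl, rfl⟩ : (a = 3 ∧ b = 1) ∨ (a = 2 ∧ b = 2) := by omega
      exacts [⟨3, rfl⟩, ⟨2, rfl⟩]
    · obtain ⟨rfl, rfl, rfl⟩ : a = 2 ∧ b = 1 ∧ d = 1 := by omega
      exact ⟨1, rfl⟩
    · obtain ⟨rfl, rfl, rfl, rfl⟩ : a = 1 ∧ b = 1 ∧ d = 1 ∧ e = 1 := by omega
      exact ⟨0, rfl⟩
    · omega

theorem enumerates_wordsFive : Enumerates 5 wordsFive where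
  injective := by decide
  sorted := by decide
  pos := by decide
  sum_eq := by decide
  exists_eq := by
    rintro (_ | ⟨a, _ | ⟨b, _ | ⟨d, _ | ⟨e, _ | ⟨k, _ | ⟨l, w⟩⟩⟩⟩⟩⟩) hs hp hsum <;>
      simp at hs hp hsum
    · subst hsum; exact ⟨6, rfl⟩
    · obtain ⟨rfl, rfl⟩ | ⟨rfl, rfl⟩ : (a = 4 ∧ b = 1) ∨ (a = 3 ∧ b = 2) := by omega
      exacts [⟨5, rfl⟩, ⟨4, rfl⟩]
    · obtain ⟨rfl, rfl, rfl⟩ | ⟨rfl, rfl, rfl⟩ :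
        (a = 3 ∧ b = 1 ∧ d = 1) ∨ (a = 2 ∧ b = 2 ∧ d = 1) := by omega
      exacts [⟨3, rfl⟩, ⟨2, rfl⟩]
    · obtain ⟨rfl, rfl, rfl, rfl⟩ : a = 2 ∧ b = 1 ∧ d = 1 ∧ e = 1 := by omega
      exact ⟨1, rfl⟩
    · obtain ⟨rfl, rfl, rfl, rfl, rfl⟩ : a = 1 ∧ b = 1 ∧ d = 1 ∧ e = 1 ∧ k = 1 := by omega
      exact ⟨0, rfl⟩
    · omega

end Words

/-! ### Block diagonalization by quasi-primaries -/

section QuasiPrimary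
variable {K : Type*} [Field K]

/-- The norm of the quasi-primary at level `2`. -/
def normTwo (c H : K) : K :=
  (4 * H + 2) * (c * (2 * H + 1) + 16 * H ^ 2 - 10 * H)

/-- The norm of the quasi-primary at level `3`. -/
def normThree (c H : K) : K :=
  2 * c * H ^ 4 + 8 * c * H ^ 3 + 10 * c * H ^ 2 + 4 * c * H + 6 * H ^ 5 + 4 * H ^ 4 - 26 * H ^ 3
      - 16 * H ^ 2 + 8 * H

/-- The norm of the first quasi-primary at level `4`. -/
def normFour (c H : K) : K :=
  1280 * c * H ^ 6 + 11520 * c * H ^ 5 + 39040 * c * H ^ 4 + 61440 * c * H ^ 3 + 43920 * c * H ^ 2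
      + 10800 * c * H + 2048 * H ^ 7 + 9472 * H ^ 6 + 4864 * H ^ 5 - 7936 * H ^ 4 + 43392 * H ^ 3
      + 59760 * H ^ 2 - 10800 * H

/-- The scalar product of the two quasi-primaries at level `4`. -/
def crossFour (c H : K) : K :=
  768 * c * H ^ 6 + 6912 * c * H ^ 5 + 23424 * c * H ^ 4 + 36864 * c * H ^ 3 + 26352 * c * H ^ 2
      + 6480 * c * H + 6144 * H ^ 7 + 36096 * H ^ 6 + 52608 * H ^ 5 - 10752 * H ^ 4
      - 15264 * H ^ 3 + 38448 * H ^ 2 - 6480 * H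

/-- The norm of the second quasi-primary at level `4`. -/
def normFour' (c H : K) : K :=
  128 * c ^ 2 * H ^ 6 + 512 * c ^ 2 * H ^ 5 + 704 * c ^ 2 * H ^ 4 + 384 * c ^ 2 * H ^ 3
      + 72 * c ^ 2 * H ^ 2 + 2048 * c * H ^ 7 + 6912 * c * H ^ 6 + 9600 * c * H ^ 5
      + 14656 * c * H ^ 4 + 22368 * c * H ^ 3 + 16128 * c * H ^ 2 + 3888 * c * H + 8192 * H ^ 8
      + 22528 * H ^ 7 + 32896 * H ^ 6 + 52352 * H ^ 5 + 1824 * H ^ 4 - 37728 * H ^ 3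
      + 24624 * H ^ 2 - 3888 * H

/-- The determinant of the Gram matrix of the two quasi-primaries at level `4`. -/
def detFour (c H : K) : K :=
  normFour c H * normFour' c H - crossFour c H ^ 2

/-- The norm of the first quasi-primary at level `5`. -/
def normFive (c H : K) : K :=
  160 * c * H ^ 8 + 2560 * c * H ^ 7 + 16760 * c * H ^ 6 + 57760 * c * H ^ 5 + 112040 * c * H ^ 4
      + 120640 * c * H ^ 3 + 65440 * c * H ^ 2 + 13440 * c * H + 160 * H ^ 9 + 1696 * H ^ 8
      + 5816 * H ^ 7 + 5176 * H ^ 6 - 9304 * H ^ 5 - 30776 * H ^ 4 - 68096 * H ^ 3 - 68256 * H ^ 2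
      + 8064 * H

/-- The scalar product of the two quasi-primaries at level `5`. -/
def crossFive (c H : K) : K :=
  64 * c * H ^ 8 + 1024 * c * H ^ 7 + 6704 * c * H ^ 6 + 23104 * c * H ^ 5 + 44816 * c * H ^ 4
      + 48256 * c * H ^ 3 + 26176 * c * H ^ 2 + 5376 * c * H + 512 * H ^ 9 + 5376 * H ^ 8
      + 16736 * H ^ 7 + 976 * H ^ 6 - 71968 * H ^ 5 - 87056 * H ^ 4 - 14016 * H ^ 3
      - 11456 * H ^ 2 + 5376 * H

/-- The norm of the second quasi-primary at level `5`. -/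
def normFive' (c H : K) : K :=
  16 * c ^ 2 * H ^ 8 + 176 * c ^ 2 * H ^ 7 + 756 * c ^ 2 * H ^ 6 + 1656 * c ^ 2 * H ^ 5
      + 2004 * c ^ 2 * H ^ 4 + 1344 * c ^ 2 * H ^ 3 + 464 * c ^ 2 * H ^ 2 + 64 * c ^ 2 * H
      + 176 * c * H ^ 9 + 1568 * c * H ^ 8 + 4948 * c * H ^ 7 + 7808 * c * H ^ 6
      + 10996 * c * H ^ 5 + 19592 * c * H ^ 4 + 23312 * c * H ^ 3 + 13152 * c * H ^ 2
      + 2688 * c * H + 384 * H ^ 10 + 2000 * H ^ 9 + 776 * H ^ 8 - 2064 * H ^ 7 + 8008 * H ^ 6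
      - 20464 * H ^ 5 - 69056 * H ^ 4 - 14016 * H ^ 3 + 128 * H ^ 2 + 3584 * H

/-- The determinant of the Gram matrix of the two quasi-primaries at level `5`. -/
def detFive (c H : K) : K :=
  normFive c H * normFive' c H - crossFive c H ^ 2

/-- The vertex of the quasi-primary at level `2`. -/
def vertexTwo (h H : K) : K :=
  H ^ 2 + 4 * H * h - H + 2 * h

/-- The vertex of the first quasi-primary at level `4`. -/
def vertexFour (h H : K) : K :=
  H ^ 4 + 8 * H ^ 3 * h + 2 * H ^ 3 + 36 * H ^ 2 * h - 3 * H ^ 2 + 36 * H * h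

/-- The vertex of the second quasi-primary at level `4`. -/
def vertexFour' (h H : K) : K :=
  H ^ 5 + 8 * H ^ 4 * h + H ^ 4 + 16 * H ^ 3 * h ^ 2 + 12 * H ^ 3 * h + H ^ 3 + 32 * H ^ 2 * h ^ 2
      + 16 * H ^ 2 * h - 3 * H ^ 2 + 12 * H * h ^ 2 + 24 * H * h

/-- A symmetric matrix with three blocks of size `1` and one of size `2`. -/
def blocksFive (a b d p q r : K) : Matrix (Fin 5) (Fin 5) K :=
  !![a, 0, 0, 0, 0; 0, b, 0, 0, 0; 0, 0, d, 0, 0; 0, 0, 0, p, q; 0, 0, 0, q, r]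

/-- A symmetric matrix with three blocks of size `1` and two of size `2`. -/
def blocksSeven (a b d p q r p' q' r' : K) : Matrix (Fin 7) (Fin 7) K :=
  !![a, 0, 0, 0, 0, 0, 0; 0, b, 0, 0, 0, 0, 0; 0, 0, d, 0, 0, 0, 0; 0, 0, 0, p, q, 0, 0;
     0, 0, 0, q, r, 0, 0; 0, 0, 0, 0, 0, p', q'; 0, 0, 0, 0, 0, q', r']

theorem blocksFive_mul_inv {a b d p q r : K} (ha : a ≠ 0) (hb : b ≠ 0) (hd : d ≠ 0)
    (hD : p * r - q ^ 2 ≠ 0) :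
    blocksFive a b d p q r * blocksFive a⁻¹ b⁻¹ d⁻¹ (r / (p * r - q ^ 2)) (-q / (p * r - q ^ 2))
      (p / (p * r - q ^ 2)) = 1 := by
  ext i j
  fin_cases i <;> fin_cases j <;>
    simp [blocksFive, Matrix.mul_apply, Fin.sum_univ_five, ha, hb, hd] <;>
    first | ring1 | (field_simp; ring1)

theorem blocksSeven_mul_inv {a b d p q r p' q' r' : K} (ha : a ≠ 0) (hb : b ≠ 0) (hd : d ≠ 0)
    (hD : p * r - q ^ 2 ≠ 0) (hD' : p' * r' - q' ^ 2 ≠ 0) :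
    blocksSeven a b d p q r p' q' r' *
      blocksSeven a⁻¹ b⁻¹ d⁻¹ (r / (p * r - q ^ 2)) (-q / (p * r - q ^ 2)) (p / (p * r - q ^ 2))
        (r' / (p' * r' - q' ^ 2)) (-q' / (p' * r' - q' ^ 2)) (p' / (p' * r' - q' ^ 2)) = 1 := by
  ext i j
  fin_cases i <;> fin_cases j <;>
    simp [blocksSeven, Matrix.mul_apply, Fin.sum_univ_seven, ha, hb, hd] <;>
    first | ring1 | (field_simp; ring1)

/-- The global descendants, at level `2`, of the quasi-primaries at levels up to `2`. -/
def quasiTwo (H : K) : Matrix (Fin 2) (Fin 2) K :=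
  !![1, 0;
      -3, 4 * H + 2]

/-- The second row is the combination of `L_{-1}²` and `L_{-2}` killed by `L_1`, hence orthogonal to
the image of `L_{-1}`. At higher levels the earlier rows are the `L_{-1}`-images of the rows one
level below, and the new rows are again killed by `L_1`. -/
theorem quasiTwo_mul_gramTwo [CharZero K] (c H : K) :
    quasiTwo H * gramTwo c H * (quasiTwo H).transpose =
      Matrix.diagonal ![4 * H * (2 * H + 1), normTwo c H] := by
  ext i j
  rw [Matrix.mul_assoc]
  simp only [Matrix.mul_apply, Matrix.transpose_apply, Fin.sum_univ_two]
  fin_cases i <;> fin_cases j <;>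
    simp [quasiTwo, gramTwo, normTwo] <;> ring1

theorem quasiTwo_mulVec_vertex (h H : K) :
    (quasiTwo H).mulVec (fun i => vertex h H (wordsTwo i)) =
      ![H * (H + 1), vertexTwo h H] := by
  ext i
  fin_cases i <;>
    simp [quasiTwo, Matrix.mulVec, dotProduct, Fin.sum_univ_two, wordsTwo, vertex,
      vertexTwo] <;> ring1

/-- The global descendants, at level `3`, of the quasi-primaries at levels up to `3`. -/
def quasiThree (H : K) : Matrix (Fin 3) (Fin 3) K :=
  !![1, 0, 0;
      -3, 4 * H + 2, 4 * H + 2;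
      1, -2 * H - 2, H ^ 2 + H]

theorem quasiThree_mul_gramThree (c H : K) :
    quasiThree H * gramThree c H * (quasiThree H).transpose =
      Matrix.diagonal ![24 * H * (2 * H + 1) * (H + 1), 2 * (H + 2) * normTwo c H,
        normThree c H] := by
  ext i j
  rw [Matrix.mul_assoc]
  simp only [Matrix.mul_apply, Matrix.transpose_apply, Fin.sum_univ_three]
  fin_cases i <;> fin_cases j <;>
    simp [quasiThree, gramThree, normTwo, normThree] <;> ring1

theorem quasiThree_mulVec_vertex (h H : K) :
    (quasiThree H).mulVec (fun i => vertex h H (wordsThree i)) =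
      ![H * (H + 1) * (H + 2), (H + 2) * vertexTwo h H, 0] := by
  ext i
  fin_cases i <;>
    simp [quasiThree, Matrix.mulVec, dotProduct, Fin.sum_univ_three, wordsThree, vertex,
      vertexTwo] <;> ring1

/-- The global descendants, at level `4`, of the quasi-primaries at levels up to `4`. -/
def quasiFour (H : K) : Matrix (Fin 5) (Fin 5) K :=
  !![1, 0, 0, 0, 0;
      -3, 4 * H + 2, 0, 8 * H + 4, 8 * H + 4;
      1, -2 * H - 2, 0, H ^ 2 - H - 2, 2 * H ^ 2 + 2 * H;
      -15, 40 * H + 60, 0, -40 * H ^ 2 - 80 * H - 30, 16 * H ^ 3 + 32 * H ^ 2 + 12 * H;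
      9 * H - 9, -24 * H ^ 2 - 12 * H + 36, 16 * H ^ 3 + 32 * H ^ 2 + 12 * H, -24 * H ^ 2 - 48 * H
        - 18, 0]

/-- Global families of different quasi-primaries are orthogonal, and `L_{-1}^k` on weight `Δ`
multiplies the norm by `k! (2Δ)(2Δ+1)⋯(2Δ+k-1)`; this is the origin of the linear factors. The two
quasi-primaries at level 4 are not orthogonal to each other, hence the single 2 by 2 block. -/
theorem quasiFour_mul_gramFour [CharZero K] (c H : K) :
    quasiFour H * gramFour c H * (quasiFour H).transpose =
      blocksFive (96 * H * (2 * H + 1) * (H + 1) * (2 * H + 3))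
        (4 * (H + 2) * (2 * H + 5) * normTwo c H)
        (2 * (H + 3) * normThree c H)
        (normFour c H)
        (crossFour c H)
        (normFour' c H) := by
  ext i j
  rw [Matrix.mul_assoc]
  simp only [Matrix.mul_apply, Matrix.transpose_apply, Fin.sum_univ_five]
  fin_cases i <;> fin_cases j <;>
    simp only [quasiFour, gramFour, blocksFive, normTwo, normThree, normFour, crossFour,
      normFour',
      Matrix.of_apply, Matrix.cons_val, Matrix.cons_val', Fin.reduceFinMk, Fin.zero_eta,
        Fin.mk_one] <;> ring1

theorem quasiFour_mulVec_vertex (h H : K) :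
    (quasiFour H).mulVec (fun i => vertex h H (wordsFour i)) =
      ![H * (H + 1) * (H + 2) * (H + 3), (H + 2) * (H + 3) * vertexTwo h H, 0, vertexFour h H,
        vertexFour' h H] := by
  ext i
  fin_cases i <;>
    simp [quasiFour, Matrix.mulVec, dotProduct, Fin.sum_univ_five, wordsFour, vertex, vertexTwo,
      vertexFour, vertexFour'] <;> ring1

/-- The global descendants, at level `5`, of the quasi-primaries at levels up to `5`. -/
def quasiFive (H : K) : Matrix (Fin 7) (Fin 7) K :=
  !![1, 0, 0, 0, 0, 0, 0;
      -3, 4 * H + 2, 0, 12 * H + 6, 0, 24 * H + 12, 24 * H + 12;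
      1, -2 * H - 2, 0, H ^ 2 - 3 * H - 4, 0, 4 * H ^ 2 - 4, 6 * H ^ 2 + 6 * H;
      -15, 40 * H + 60, 0, -40 * H ^ 2 - 40 * H + 30, 0, 16 * H ^ 3 - 48 * H ^ 2 - 148 * H - 60,
        48 * H ^ 3 + 96 * H ^ 2 + 36 * H;
      9 * H - 9, -24 * H ^ 2 - 12 * H + 36, 16 * H ^ 3 + 32 * H ^ 2 + 12 * H, -48 * H ^ 2 - 60 * H
        + 18, 32 * H ^ 3 + 64 * H ^ 2 + 24 * H, -48 * H ^ 2 - 96 * H - 36, 16 * H ^ 3 + 32 * H ^ 2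
        + 12 * H;
      3, -10 * H - 20, 0, 15 * H ^ 2 + 45 * H + 30, 0, -12 * H ^ 3 - 42 * H ^ 2 - 42 * H - 12,
        4 * H ^ 4 + 14 * H ^ 3 + 14 * H ^ 2 + 4 * H;
      -3 * H, 10 * H ^ 2 + 20 * H, -8 * H ^ 3 - 28 * H ^ 2 - 28 * H - 8, -3 * H ^ 3 - 3 * H ^ 2
        + 12 * H + 12, 4 * H ^ 4 + 14 * H ^ 3 + 14 * H ^ 2 + 4 * H, 0, 0]

set_option maxHeartbeats 2000000 in
theorem quasiFive_mul_gramFive (c H : K) :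
    quasiFive H * gramFive c H * (quasiFive H).transpose =
      blocksSeven (960 * H * (2 * H + 1) * (H + 1) * (2 * H + 3) * (H + 2))
        (24 * (H + 2) * (2 * H + 5) * (H + 3) * normTwo c H)
        (4 * (H + 3) * (2 * H + 7) * normThree c H)
        (2 * (H + 4) * normFour c H)
        (2 * (H + 4) * crossFour c H)
        (2 * (H + 4) * normFour' c H)
        (normFive c H)
        (crossFive c H)
        (normFive' c H) := by
  ext i j
  rw [Matrix.mul_assoc]
  simp only [Matrix.mul_apply, Matrix.transpose_apply, Fin.sum_univ_seven]
  fin_cases i <;> fin_cases j <;>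
    simp only [quasiFive, gramFive, blocksSeven, normTwo, normThree, normFour, crossFour,
      normFour', normFive, crossFive, normFive',
      Matrix.of_apply, Matrix.cons_val, Matrix.cons_val', Fin.reduceFinMk, Fin.zero_eta,
        Fin.mk_one] <;> ring1

/-- With equal external dimensions the quasi-primaries of odd level decouple: the zero entries are
the level-3 family and both new level-5 vectors. Thus `normFive`, `crossFive` and `normFive'` matter
only for invertibility of the Gram matrix. -/
theorem quasiFive_mulVec_vertex (h H : K) :
    (quasiFive H).mulVec (fun i => vertex h H (wordsFive i)) =
      ![H * (H + 1) * (H + 2) * (H + 3) * (H + 4), (H + 2) * (H + 3) * (H + 4) * vertexTwo h H, 0,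
        (H + 4) * vertexFour h H, (H + 4) * vertexFour' h H, 0, 0] := by
  ext i
  fin_cases i <;>
    simp [quasiFive, Matrix.mulVec, dotProduct, Fin.sum_univ_seven, wordsFive, vertex, vertexTwo,
      vertexFour, vertexFour'] <;> ring1

end QuasiPrimary

/-! ### Closed forms of the block coefficients -/

section Coefficients
variable {K : Type*} [Field K]

/-- The contravariant form is nondegenerate at levels up to `5`. -/
structure Nondegenerate (c H : K) : Prop where
  ne_zero : H ≠ 0
  add_one_ne : H + 1 ≠ 0
  add_two_ne : H + 2 ≠ 0
  add_three_ne : H + 3 ≠ 0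
  add_four_ne : H + 4 ≠ 0
  two_mul_add_one_ne : 2 * H + 1 ≠ 0
  two_mul_add_three_ne : 2 * H + 3 ≠ 0
  two_mul_add_five_ne : 2 * H + 5 ≠ 0
  two_mul_add_seven_ne : 2 * H + 7 ≠ 0
  normTwo_ne : normTwo c H ≠ 0
  normThree_ne : normThree c H ≠ 0
  detFour_ne : detFour c H ≠ 0
  detFive_ne : detFive c H ≠ 0

/-- The contribution of the quasi-primary at level `2`. -/
def ampTwo (c h H : K) : K := vertexTwo h H ^ 2 / normTwo c H

/-- The contribution of the quasi-primaries at level `4`. -/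
def ampFour (c h H : K) : K :=
  (vertexFour h H ^ 2 * normFour' c H - 2 * vertexFour h H * vertexFour' h H * crossFour c H
    + vertexFour' h H ^ 2 * normFour c H) / detFour c H

theorem blockCoeff_zero (c h H : K) : blockCoeff c h H 0 = 1 := by
  have hw : word (default : Nat.Partition 0) = [] := by simp [word]
  have hg : gram c H 0 = 1 := by
    ext i j
    rw [Subsingleton.elim i default, Subsingleton.elim j default, gram, hw]
    simp [shapovalov]
  simp [blockCoeff, hg, hw, vertex]

theorem diagonal_mul_inv {ι : Type*} [Fintype ι] [DecidableEq ι] {d : ι → K}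
    (hd : ∀ i, d i ≠ 0) : Matrix.diagonal d * Matrix.diagonal (fun i => (d i)⁻¹) = 1 := by
  rw [Matrix.diagonal_mul_diagonal, ← Matrix.diagonal_one]
  congr 1
  ext i
  exact mul_inv_cancel₀ (hd i)

variable [CharZero K]

theorem blockCoeff_one {c h H : K} (hH : H ≠ 0) : blockCoeff c h H 1 = H / 2 := by
  rw [enumerates_wordsOne.blockCoeff_eq]
  have : (Matrix.of fun i j => pairing c H (wordsOne i) (wordsOne j)) = gramOne H := by
    ext i j; exact pairing_wordsOne c H i j
  rw [this]
  simp [gramOne, wordsOne, vertex, Ring.inverse_eq_inv']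
  field_simp

theorem blockCoeff_two {c h H : K} (hnd : Nondegenerate c H) :
    blockCoeff c h H 2 = H * (H + 1) ^ 2 / (4 * (2 * H + 1)) + ampTwo c h H := by
  obtain ⟨h0, h1, h2, h3, h4, h5, h6, h7, h8, h9, h10, h11, h12⟩ := hnd
  rw [blockCoeff_eq_of_diagonalization enumerates_wordsTwo (pairing_wordsTwo c H)
    (quasiTwo_mul_gramTwo c H)
    (diagonal_mul_inv (by intro i; fin_cases i <;> simp [h0, h5, h9]))
    (quasiTwo_mulVec_vertex h H)]
  simp [Matrix.diagonal, ampTwo, Fin.sum_univ_two, -mul_inv_rev]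
  field_simp

theorem blockCoeff_three {c h H : K} (hnd : Nondegenerate c H) :
    blockCoeff c h H 3 = H * (H + 1) * (H + 2) ^ 2 / (24 * (2 * H + 1))
      + ampTwo c h H * (H + 2) / 2 := by
  obtain ⟨h0, h1, h2, h3, h4, h5, h6, h7, h8, h9, h10, h11, h12⟩ := hnd
  rw [blockCoeff_eq_of_diagonalization enumerates_wordsThree (pairing_wordsThree c H)
    (quasiThree_mul_gramThree c H)
    (diagonal_mul_inv (by intro i; fin_cases i <;> simp [h0, h1, h2, h5, h9, h10]))
    (quasiThree_mulVec_vertex h H)]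
  simp [Matrix.diagonal, ampTwo, Fin.sum_univ_three, -mul_inv_rev]
  field_simp

theorem blockCoeff_four {c h H : K} (hnd : Nondegenerate c H) :
    blockCoeff c h H 4 = H * (H + 1) * (H + 2) ^ 2 * (H + 3) ^ 2 / (96 * (2 * H + 1) * (2 * H + 3))
      + ampTwo c h H * ((H + 2) * (H + 3) ^ 2) / (4 * (2 * H + 5)) + ampFour c h H := by
  obtain ⟨h0, h1, h2, h3, h4, h5, h6, h7, h8, h9, h10, h11, h12⟩ := hnd
  rw [blockCoeff_eq_of_diagonalization enumerates_wordsFour (pairing_wordsFour c H)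
    (quasiFour_mul_gramFour c H)
    (blocksFive_mul_inv (by simp [h0, h1, h5, h6]) (by simp [h2, h7, h9]) (by simp [h3, h10])
      (by rwa [detFour] at h11)) (quasiFour_mulVec_vertex h H)]
  rw [← detFour]
  simp [blocksFive, ampTwo, ampFour, Fin.sum_univ_five, -mul_inv_rev]
  field_simp
  ring

theorem blockCoeff_five {c h H : K} (hnd : Nondegenerate c H) :
    blockCoeff c h H 5 =
      H * (H + 1) * (H + 2) * (H + 3) ^ 2 * (H + 4) ^ 2 / (960 * (2 * H + 1) * (2 * H + 3))
      + ampTwo c h H * ((H + 2) * (H + 3) * (H + 4) ^ 2) / (24 * (2 * H + 5))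
      + ampFour c h H * (H + 4) / 2 := by
  obtain ⟨h0, h1, h2, h3, h4, h5, h6, h7, h8, h9, h10, h11, h12⟩ := hnd
  -- At level 5 the level-4 pair appears through its `L_{-1}`-images. Every entry of its 2 by 2
  -- block acquires the factor `2 (H + 4)`, so the determinant acquires its square.
  have e4 : 2 * (H + 4) * normFour c H * (2 * (H + 4) * normFour' c H)
      - (2 * (H + 4) * crossFour c H) ^ 2 = (2 * (H + 4)) ^ 2 * detFour c H := by
    rw [detFour]; ring
  rw [blockCoeff_eq_of_diagonalization enumerates_wordsFive (pairing_wordsFive c H)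
    (quasiFive_mul_gramFive c H)
    (blocksSeven_mul_inv (by simp [h0, h1, h2, h5, h6]) (by simp [h2, h3, h7, h9])
      (by simp [h3, h8, h10]) (by simp [e4, h4, h11]) (by rwa [detFive] at h12))
    (quasiFive_mulVec_vertex h H), e4]
  simp [blocksSeven, ampTwo, ampFour, Fin.sum_univ_seven, -mul_inv_rev]
  field_simp
  ring

end Coefficients

/-! ### Coefficients of the logarithm -/

section Log
open PowerSeries

/-- Substitute `F - 1` for `X` in `(1 + X) · log(1 + X)' = 1` and apply the chain rule. Comparing
coefficients then yields a triangular recursion for `log F`. -/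
theorem mul_derivative_logOf {A : Type*} [CommRing A] [Algebra ℚ A] {F : PowerSeries A}
    (hF : constantCoeff F = 1) :
    F * derivative A (logOf F) = derivative A F := by
  have hs : HasSubst (F - 1) := HasSubst.of_constantCoeff_zero' (by simp [hF])
  have hgeom : (1 + X : PowerSeries A) * derivative A (log A) = 1 := by
    rw [deriv_log]
    ext n
    cases n with
    | zero => simp [add_mul]
    | succ n => simp [add_mul, coeff_succ_X_mul, pow_succ, coeff_one]
  have h1 := congrArg (subst (F - 1)) hgeom
  have hone : subst (F - 1) (1 : PowerSeries A) = 1 := by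
    rw [← coe_substAlgHom hs, map_one]
  rw [subst_mul hs, subst_add hs, subst_X hs, hone, add_sub_cancel] at h1
  rw [logOf_eq, derivative_subst hs, ← mul_assoc, h1, one_mul, map_sub]
  simp

theorem coeff_logOf_recursion {A : Type*} [CommRing A] [Algebra ℚ A] {F : PowerSeries A}
    (hF : constantCoeff F = 1) (n : ℕ) :
    ∑ ij ∈ Finset.HasAntidiagonal.antidiagonal n, coeff ij.1 F * (coeff (ij.2 + 1) (logOf F) * (ij.2 + 1)) =
      coeff (n + 1) F * (n + 1) := by
  have := congrArg (coeff n) (mul_derivative_logOf hF)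
  simpa [coeff_mul, coeff_derivative] using this

variable {K : Type*} [Field K] [Algebra ℚ K] {F : PowerSeries K}

theorem coeff_logOf (hF : coeff 0 F = 1) :
    coeff 1 (logOf F) = coeff 1 F ∧
    coeff 2 (logOf F) = coeff 2 F - coeff 1 F ^ 2 / 2 ∧
    coeff 3 (logOf F) = coeff 3 F - coeff 1 F * coeff 2 F + coeff 1 F ^ 3 / 3 ∧
    coeff 4 (logOf F) = coeff 4 F - coeff 1 F * coeff 3 F - coeff 2 F ^ 2 / 2
      + coeff 1 F ^ 2 * coeff 2 F - coeff 1 F ^ 4 / 4 ∧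
    coeff 5 (logOf F) = coeff 5 F - coeff 1 F * coeff 4 F - coeff 2 F * coeff 3 F
      + coeff 1 F ^ 2 * coeff 3 F + coeff 1 F * coeff 2 F ^ 2 - coeff 1 F ^ 3 * coeff 2 F
      + coeff 1 F ^ 5 / 5 := by
  have := algebraRat.charZero K
  have hr := coeff_logOf_recursion (F := F) (by simpa using hF)
  have h0 := hr 0
  have h1 := hr 1
  have h2 := hr 2
  have h3 := hr 3
  have h4 := hr 4
  simp only [Finset.Nat.antidiagonal_succ, Finset.Nat.antidiagonal_zero, Finset.map_singleton,
    Finset.sum_cons, Finset.sum_singleton, Finset.map_cons,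
    Function.Embedding.coe_prodMap, Function.Embedding.coeFn_mk, Prod.map_apply, hF] at h0 h1 h2 h3 h4
  norm_num [hF] at h0 h1 h2 h3 h4
  have e1 : coeff 1 (logOf F) = coeff 1 F := h0
  have e2 : coeff 2 (logOf F) = coeff 2 F - coeff 1 F ^ 2 / 2 := by
    rw [e1] at h1; linear_combination h1 / 2
  have e3 : coeff 3 (logOf F) = coeff 3 F - coeff 1 F * coeff 2 F + coeff 1 F ^ 3 / 3 := by
    rw [e1, e2] at h2; linear_combination h2 / 3
  have e4 : coeff 4 (logOf F) = coeff 4 F - coeff 1 F * coeff 3 F - coeff 2 F ^ 2 / 2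
      + coeff 1 F ^ 2 * coeff 2 F - coeff 1 F ^ 4 / 4 := by
    rw [e1, e2, e3] at h3; linear_combination h3 / 4
  refine ⟨e1, e2, e3, e4, ?_⟩
  rw [e1, e2, e3, e4] at h4
  linear_combination h4 / 5

variable {c h H : K}

theorem coeff_one_log_block (hnd : Nondegenerate c H) :
    coeff 1 (logOf (block c h H)) = H / 2 := by
  have := algebraRat.charZero K
  rw [(coeff_logOf (by simp [block, blockCoeff_zero])).1, block, coeff_mk,
    blockCoeff_one hnd.ne_zero]

theorem coeff_two_log_block (hnd : Nondegenerate c H) :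
    coeff 2 (logOf (block c h H)) = H * (3 * H + 2) / (8 * (2 * H + 1)) + ampTwo c h H := by
  have := algebraRat.charZero K
  rw [(coeff_logOf (by simp [block, blockCoeff_zero])).2.1]
  simp only [block, coeff_mk, blockCoeff_one hnd.ne_zero, blockCoeff_two hnd]
  have h1 : H * 2 + 1 ≠ 0 := by simpa only [mul_comm] using hnd.two_mul_add_one_ne
  field_simp
  ring

theorem coeff_three_log_block (hnd : Nondegenerate c H) :
    coeff 3 (logOf (block c h H)) = H * (5 * H + 4) / (24 * (2 * H + 1)) + ampTwo c h H := by
  have := algebraRat.charZero K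
  rw [(coeff_logOf (by simp [block, blockCoeff_zero])).2.2.1]
  simp only [block, coeff_mk, blockCoeff_one hnd.ne_zero, blockCoeff_two hnd,
    blockCoeff_three hnd]
  have h1 : H * 2 + 1 ≠ 0 := by simpa only [mul_comm] using hnd.two_mul_add_one_ne
  field_simp
  ring

/-- The level-4 amplitude is grouped with `-ampTwo² / 2` because only this connected combination has
a mild large-`c` behaviour. At level 5 the same combination returns, with factor `(H + 4)/2 - H/2 =
2`. -/
theorem coeff_four_log_block (hnd : Nondegenerate c H) :
    coeff 4 (logOf (block c h H)) =
      H * (35 * H ^ 3 + 102 * H ^ 2 + 90 * H + 24) / (64 * (2 * H + 1) ^ 2 * (2 * H + 3))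
      + ampTwo c h H * ((7 * H ^ 2 + 21 * H + 9) / (2 * (2 * H + 1) * (2 * H + 5)))
      + (ampFour c h H - ampTwo c h H ^ 2 / 2) := by
  have := algebraRat.charZero K
  rw [(coeff_logOf (by simp [block, blockCoeff_zero])).2.2.2.1]
  simp only [block, coeff_mk, blockCoeff_one hnd.ne_zero, blockCoeff_two hnd,
    blockCoeff_three hnd, blockCoeff_four hnd]
  have h1 : H * 2 + 1 ≠ 0 := by simpa only [mul_comm] using hnd.two_mul_add_one_ne
  have h3 : H * 2 + 3 ≠ 0 := by simpa only [mul_comm] using hnd.two_mul_add_three_ne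
  have h5 : H * 2 + 5 ≠ 0 := by simpa only [mul_comm] using hnd.two_mul_add_five_ne
  field_simp
  ring

theorem coeff_five_log_block (hnd : Nondegenerate c H) :
    coeff 5 (logOf (block c h H)) =
      H * (63 * H ^ 3 + 190 * H ^ 2 + 174 * H + 48) / (160 * (2 * H + 1) ^ 2 * (2 * H + 3))
      + ampTwo c h H * ((3 * H ^ 2 + 9 * H + 4) / ((2 * H + 1) * (2 * H + 5)))
      + 2 * (ampFour c h H - ampTwo c h H ^ 2 / 2) := by
  have := algebraRat.charZero K
  rw [(coeff_logOf (by simp [block, blockCoeff_zero])).2.2.2.2]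
  simp only [block, coeff_mk, blockCoeff_one hnd.ne_zero, blockCoeff_two hnd,
    blockCoeff_three hnd, blockCoeff_four hnd, blockCoeff_five hnd]
  have h1 : H * 2 + 1 ≠ 0 := by simpa only [mul_comm] using hnd.two_mul_add_one_ne
  have h3 : H * 2 + 3 ≠ 0 := by simpa only [mul_comm] using hnd.two_mul_add_three_ne
  have h5 : H * 2 + 5 ≠ 0 := by simpa only [mul_comm] using hnd.two_mul_add_five_ne
  field_simp
  ring

end Log

/-! ### Arithmetic of expansions modulo terms smaller than `c^{-α}` -/

section Expansions

/-- The series `c^{-α}`. -/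
def smallV (α : ℚ) : LargeC := HahnSeries.single α 1

/-- The series `c^{α - 1}`. -/
def smallS (α : ℚ) : LargeC := HahnSeries.single (1 - α) 1

/-- The series `∑ aₖ c^{k (α - 1)}`. -/
def evalS (α : ℚ) : PowerSeries ℝ →+* LargeC  where
  toFun a := PowerSeries.heval (smallS α) a
  map_one' := map_one _
  map_mul' := map_mul _
  map_zero' := map_zero _
  map_add' := map_add _

theorem evalS_apply (α : ℚ) (a : PowerSeries ℝ) :
    evalS α a = PowerSeries.heval (smallS α) a := rfl

/-- `x` agrees with `∑ aₖ c^{k (α - 1)} + b c^{-α}` up to terms of order smaller than `c^{-α}`. -/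
def Expands (α : ℚ) (x : LargeC) (a : PowerSeries ℝ) (b : ℝ) : Prop :=
  (α : WithTop ℚ) < (x - evalS α a - HahnSeries.C b * smallV α).orderTop

variable {α : ℚ}

theorem orderTop_smallS_pos (h1 : α < 1) : 0 < (smallS α).orderTop := by
  rw [smallS, HahnSeries.orderTop_single one_ne_zero]
  exact_mod_cast sub_pos.2 h1

theorem evalS_X (h1 : α < 1) : evalS α PowerSeries.X = smallS α :=
  PowerSeries.heval_X _ (orderTop_smallS_pos h1)

theorem evalS_C (r : ℝ) : evalS α (PowerSeries.C r) = HahnSeries.C r := by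
  rw [evalS_apply, PowerSeries.heval_C, HahnSeries.C_apply, ← HahnSeries.single_zero_one]
  ext g
  simp [HahnSeries.coeff_single]

theorem coeff_evalS_term (h1 : α < 1) (a : PowerSeries ℝ) (e : ℚ) (n : ℕ) :
    (HahnSeries.SummableFamily.powerSeriesFamily (smallS α) a).coeff e n =
      if e = n * (1 - α) then PowerSeries.coeff n a else 0 := by
  rw [HahnSeries.SummableFamily.coeff_apply,
    HahnSeries.SummableFamily.powerSeriesFamily_of_orderTop_pos (orderTop_smallS_pos h1), smallS,
    HahnSeries.single_pow]
  simp [HahnSeries.coeff_single]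

theorem coeff_evalS (h1 : α < 1) (a : PowerSeries ℝ) (k : ℕ) :
    (evalS α a).coeff (k * (1 - α)) = PowerSeries.coeff k a := by
  rw [evalS_apply, PowerSeries.coeff_heval, finsum_eq_single _ k]
  · rw [coeff_evalS_term h1, if_pos rfl]
  · intro n hn
    rw [coeff_evalS_term h1, if_neg]
    intro h
    exact hn (by exact_mod_cast (mul_right_cancel₀ (sub_pos.2 h1).ne' h).symm)

theorem coeff_evalS_of_ne (h1 : α < 1) (a : PowerSeries ℝ) {e : ℚ}
    (he : ∀ k : ℕ, e ≠ k * (1 - α)) : (evalS α a).coeff e = 0 := by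
  rw [evalS_apply, PowerSeries.coeff_heval]
  refine finsum_eq_zero_of_forall_eq_zero fun n => ?_
  rw [coeff_evalS_term h1, if_neg (he n)]

theorem orderTop_evalS_nonneg (h1 : α < 1) (a : PowerSeries ℝ) : 0 ≤ (evalS α a).orderTop := by
  rw [HahnSeries.le_orderTop_iff_forall]
  intro e he
  refine coeff_evalS_of_ne h1 a fun k hk => ?_
  have h2 : (0 : ℚ) ≤ k * (1 - α) := mul_nonneg (Nat.cast_nonneg k) (sub_nonneg.2 h1.le)
  have h3 : e < 0 := by exact_mod_cast he
  linarith

theorem orderTop_C_nonneg (r : ℝ) : 0 ≤ (HahnSeries.C r : LargeC).orderTop := by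
  rw [HahnSeries.C_apply]
  exact_mod_cast HahnSeries.orderTop_single_le

theorem le_orderTop_smallV : (α : WithTop ℚ) ≤ (smallV α).orderTop :=
  HahnSeries.orderTop_single_le

theorem lt_orderTop_add {x y : LargeC} {t : WithTop ℚ} (hx : t < x.orderTop)
    (hy : t < y.orderTop) : t < (x + y).orderTop :=
  (lt_min hx hy).trans_le HahnSeries.min_orderTop_le_orderTop_add

theorem le_orderTop_add {x y : LargeC} {t : WithTop ℚ} (hx : t ≤ x.orderTop)
    (hy : t ≤ y.orderTop) : t ≤ (x + y).orderTop :=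
  (le_min hx hy).trans HahnSeries.min_orderTop_le_orderTop_add

theorem orderTop_mul_nonneg {x y : LargeC} (hx : 0 ≤ x.orderTop) (hy : 0 ≤ y.orderTop) :
    0 ≤ (x * y).orderTop := by
  rw [HahnSeries.orderTop_mul]
  exact add_nonneg hx hy

theorem lt_orderTop_mul {x y : LargeC} (hx : (α : WithTop ℚ) < x.orderTop)
    (hy : 0 ≤ y.orderTop) : (α : WithTop ℚ) < (x * y).orderTop := by
  rw [HahnSeries.orderTop_mul]
  exact hx.trans_le (le_add_of_nonneg_right hy)

/-- Removing the constant term exposes a factor `v s = c^{-1}`, and `1 > α`. Hence only constant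
terms of the `s`-series contribute to the coefficient of `v` in a product. -/
theorem lt_orderTop_smallV_mul (h1 : α < 1) (a : PowerSeries ℝ) :
    (α : WithTop ℚ) <
      (smallV α * (evalS α a - HahnSeries.C (PowerSeries.constantCoeff a))).orderTop := by
  have ha := PowerSeries.eq_X_mul_shift_add_const a
  have h2 : smallV α * (evalS α a - HahnSeries.C (PowerSeries.constantCoeff a)) =
      (smallV α * smallS α) * evalS α (PowerSeries.mk fun p => PowerSeries.coeff (p + 1) a) := by
    conv_lhs => rw [ha]
    rw [map_add, map_mul, evalS_X h1, evalS_C]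
    simp
    ring
  rw [h2]
  refine lt_orderTop_mul ?_ (orderTop_evalS_nonneg h1 _)
  rw [smallV, smallS, HahnSeries.single_mul_single]
  exact HahnSeries.lt_orderTop_single (by linarith)

namespace Expands

variable {x y : LargeC} {a a' : PowerSeries ℝ} {b b' : ℝ}

theorem const (r : ℝ) : Expands α (HahnSeries.C r) (PowerSeries.C r) 0 := by
  simp [Expands, evalS_C]

theorem smallV : Expands α (smallV α) 0 1 := by
  simp [Expands]

theorem smallS (h1 : α < 1) : Expands α (smallS α) PowerSeries.X 0 := by
  simp [Expands, evalS_X h1]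

theorem add (hx : Expands α x a b) (hy : Expands α y a' b') :
    Expands α (x + y) (a + a') (b + b') := by
  refine (lt_orderTop_add hx hy).trans_eq (congrArg HahnSeries.orderTop ?_)
  simp only [map_add]
  ring

theorem neg (hx : Expands α x a b) : Expands α (-x) (-a) (-b) := by
  rw [Expands, ← HahnSeries.orderTop_neg] at hx
  refine hx.trans_eq (congrArg HahnSeries.orderTop ?_)
  simp only [map_neg]
  ring

theorem sub (hx : Expands α x a b) (hy : Expands α y a' b') :
    Expands α (x - y) (a - a') (b - b') := by
  simpa only [sub_eq_add_neg] using hx.add hy.neg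

theorem orderTop_nonneg (h0 : 0 < α) (h1 : α < 1) (hx : Expands α x a b) : 0 ≤ x.orderTop := by
  have hα : (0 : WithTop ℚ) ≤ α := by exact_mod_cast h0.le
  have h2 : x = (x - evalS α a - HahnSeries.C b * VirasoroBlock.smallV α) + evalS α a
      + HahnSeries.C b * VirasoroBlock.smallV α := by ring
  rw [h2]
  exact le_orderTop_add (le_orderTop_add (hα.trans hx.le) (orderTop_evalS_nonneg h1 a))
    (orderTop_mul_nonneg (orderTop_C_nonneg b) (hα.trans le_orderTop_smallV))

theorem mul (h0 : 0 < α) (h1 : α < 1) (hx : Expands α x a b) (hy : Expands α y a' b') :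
    Expands α (x * y) (a * a')
      (PowerSeries.constantCoeff a * b' + PowerSeries.constantCoeff a' * b) := by
  have hv : (α : WithTop ℚ) < (VirasoroBlock.smallV α * VirasoroBlock.smallV α).orderTop := by
    rw [VirasoroBlock.smallV, HahnSeries.single_mul_single]
    exact HahnSeries.lt_orderTop_single (by linarith)
  have hα : (0 : WithTop ℚ) ≤ α := by exact_mod_cast h0.le
  have hx' : 0 ≤ (evalS α a + HahnSeries.C b * VirasoroBlock.smallV α).orderTop :=
    le_orderTop_add (orderTop_evalS_nonneg h1 a)
      (orderTop_mul_nonneg (orderTop_C_nonneg b) (hα.trans le_orderTop_smallV))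
  have t1 := lt_orderTop_mul hx (hy.orderTop_nonneg h0 h1)
  have t2 := lt_orderTop_mul hy hx'
  have t3 := lt_orderTop_mul (lt_orderTop_smallV_mul h1 a) (orderTop_C_nonneg b')
  have t4 := lt_orderTop_mul (lt_orderTop_smallV_mul h1 a') (orderTop_C_nonneg b)
  have t5 := lt_orderTop_mul hv (orderTop_C_nonneg (b * b'))
  have := lt_orderTop_add (lt_orderTop_add (lt_orderTop_add (lt_orderTop_add t1 t2) t3) t4) t5
  refine this.trans_eq (congrArg HahnSeries.orderTop ?_)
  simp only [map_add, map_mul]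
  ring

theorem coeff_eq (hx : Expands α x a b) {e : ℚ} (he : e ≤ α) :
    x.coeff e = (evalS α a).coeff e + if e = α then b else 0 := by
  have h2 := HahnSeries.coeff_eq_zero_of_lt_orderTop
    ((WithTop.coe_le_coe.2 he).trans_lt hx)
  rw [HahnSeries.coeff_sub, HahnSeries.coeff_sub, HahnSeries.C_mul_eq_smul,
    HahnSeries.coeff_smul, VirasoroBlock.smallV, HahnSeries.coeff_single] at h2
  split_ifs at h2 ⊢ <;> simp at h2 ⊢ <;> linarith

theorem coeff_zero (h0 : 0 < α) (h1 : α < 1) (hx : Expands α x a b) :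
    x.coeff 0 = PowerSeries.constantCoeff a := by
  rw [hx.coeff_eq h0.le, if_neg h0.ne, add_zero]
  simpa using coeff_evalS h1 a 0

theorem ne_zero (h0 : 0 < α) (h1 : α < 1) (hx : Expands α x a b)
    (ha : PowerSeries.constantCoeff a ≠ 0) : x ≠ 0 := by
  rintro rfl
  exact ha (by rw [← hx.coeff_zero h0 h1]; rfl)

/-- The candidate `y` is the formal inverse to first order in `v`. Then `x y = 1` up to negligible
terms, and multiplying by `x⁻¹`, which has order zero because the leading coefficient of `x` is
nonzero, keeps the error negligible. -/
theorem inv (h0 : 0 < α) (h1 : α < 1) (hx : Expands α x a b)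
    (ha : PowerSeries.constantCoeff a ≠ 0) :
    Expands α x⁻¹ a⁻¹ (-b / PowerSeries.constantCoeff a ^ 2) := by
  set r := PowerSeries.constantCoeff a with hr
  set y := evalS α a⁻¹ + HahnSeries.C (-b / r ^ 2) * VirasoroBlock.smallV α with hy
  have hyE : Expands α y a⁻¹ (-b / r ^ 2) := by
    simp [Expands, hy]
  have hxy := hx.mul h0 h1 hyE
  rw [PowerSeries.mul_inv_cancel _ ha, PowerSeries.constantCoeff_inv, ← hr] at hxy
  have hb : r * (-b / r ^ 2) + r⁻¹ * b = 0 := by field_simp; ring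
  rw [hb, Expands, map_one, map_zero, zero_mul, sub_zero] at hxy
  have hx0 : x.orderTop = 0 := by
    refine le_antisymm ?_ (hx.orderTop_nonneg h0 h1)
    refine HahnSeries.orderTop_le_of_coeff_ne_zero ?_
    rwa [hx.coeff_zero h0 h1]
  have hxi : x⁻¹.orderTop = 0 := by
    have h2 := HahnSeries.orderTop_mul x x⁻¹
    rw [mul_inv_cancel₀ (hx.ne_zero h0 h1 ha), hx0, zero_add, HahnSeries.orderTop_one] at h2
    exact h2.symm
  have h3 := lt_orderTop_mul hxy hxi.ge
  rw [← HahnSeries.orderTop_neg] at h3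
  refine h3.trans_eq (congrArg HahnSeries.orderTop ?_)
  have := mul_inv_cancel₀ (hx.ne_zero h0 h1 ha)
  rw [sub_sub, ← hy]
  linear_combination -y * this

theorem div (h0 : 0 < α) (h1 : α < 1) (hx : Expands α x a b) (hy : Expands α y a' b')
    (ha : PowerSeries.constantCoeff a' ≠ 0) :
    Expands α (x / y) (a * a'⁻¹) (PowerSeries.constantCoeff a *
      (-b' / PowerSeries.constantCoeff a' ^ 2) + (PowerSeries.constantCoeff a')⁻¹ * b) := by
  have := hx.mul h0 h1 (hy.inv h0 h1 ha)
  rwa [PowerSeries.constantCoeff_inv, ← div_eq_mul_inv] at this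

end Expands

end Expansions

/-! ### Rescaling by powers of `v` and `s` -/

section Scaling

section

variable {K : Type*} [CommRing K]

/-- The rescaled norm at level `2`. -/
def scaledNormTwo (v s d : K) : K := (4 * d + 2 * v) * (2 * d + v + s * (16 * d ^ 2 - 10 * d * v))

/-- The rescaled vertex at level `2`. -/
def scaledVertexTwo (v d e : K) : K :=
  4 * d * e + d ^ 2 + 2 * e * v - d * v

/-- The rescaled norm at level `3`. -/
def scaledNormThree (v s d : K) : K :=
  2 * d ^ 4 + 6 * d ^ 5 * s + 8 * d ^ 3 * v + 4 * d ^ 4 * v * s + 10 * d ^ 2 * v ^ 2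
    - 26 * d ^ 3 * v ^ 2 * s + 4 * d * v ^ 3 - 16 * d ^ 2 * v ^ 3 * s + 8 * d * v ^ 4 * s

/-- The rescaled first norm at level `4`. -/
def scaledNormFour (v s d : K) : K :=
  1280 * d ^ 6 + 2048 * d ^ 7 * s + 11520 * d ^ 5 * v + 9472 * d ^ 6 * v * s
    + 39040 * d ^ 4 * v ^ 2 + 4864 * d ^ 5 * v ^ 2 * s + 61440 * d ^ 3 * v ^ 3
    - 7936 * d ^ 4 * v ^ 3 * s + 43920 * d ^ 2 * v ^ 4 + 43392 * d ^ 3 * v ^ 4 * s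
    + 10800 * d * v ^ 5 + 59760 * d ^ 2 * v ^ 5 * s - 10800 * d * v ^ 6 * s

/-- The rescaled scalar product at level `4`. -/
def scaledCrossFour (v s d : K) : K :=
  768 * d ^ 6 + 6144 * d ^ 7 * s + 6912 * d ^ 5 * v + 36096 * d ^ 6 * v * s
    + 23424 * d ^ 4 * v ^ 2 + 52608 * d ^ 5 * v ^ 2 * s + 36864 * d ^ 3 * v ^ 3
    - 10752 * d ^ 4 * v ^ 3 * s + 26352 * d ^ 2 * v ^ 4 - 15264 * d ^ 3 * v ^ 4 * s
    + 6480 * d * v ^ 5 + 38448 * d ^ 2 * v ^ 5 * s - 6480 * d * v ^ 6 * s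

/-- The rescaled deviation of the second norm at level `4` from its factorized form. -/
def excessNormFour (v s d : K) : K :=
  256 * d ^ 5 + 5120 * d ^ 6 * s + 24576 * d ^ 7 * s ^ 2 + 512 * d ^ 4 * v
    + 9984 * d ^ 5 * v * s + 37888 * d ^ 6 * v * s ^ 2 + 320 * d ^ 3 * v ^ 2
    + 15360 * d ^ 4 * v ^ 2 * s + 51712 * d ^ 5 * v ^ 2 * s ^ 2 + 64 * d ^ 2 * v ^ 3
    + 22528 * d ^ 3 * v ^ 3 * s + 1024 * d ^ 4 * v ^ 3 * s ^ 2 + 16128 * d ^ 2 * v ^ 4 * s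
    - 37728 * d ^ 3 * v ^ 4 * s ^ 2 + 3888 * d * v ^ 5 * s + 24624 * d ^ 2 * v ^ 5 * s ^ 2
    - 3888 * d * v ^ 6 * s ^ 2

/-- The rescaled first vertex at level `4`. -/
def scaledVertexFour (v d e : K) : K :=
  8 * d ^ 3 * e + d ^ 4 + 36 * d ^ 2 * e * v + 2 * d ^ 3 * v + 36 * d * e * v ^ 2
    - 3 * d ^ 2 * v ^ 2

/-- The rescaled deviation of the second vertex at level `4` from its factorized form. -/
def excessVertexFour (v d e : K) : K :=
  16 * d ^ 2 * e ^ 2 + 16 * d ^ 3 * e + 3 * d ^ 4 + 8 * d * e ^ 2 * v + 20 * d ^ 2 * e * v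
    + 24 * d * e * v ^ 2 - 3 * d ^ 2 * v ^ 2

/-- The rescaled first norm at level `5`. -/
def scaledNormFive (v s d : K) : K :=
  160 * d ^ 8 + 160 * d ^ 9 * s + 2560 * d ^ 7 * v + 1696 * d ^ 8 * v * s
    + 16760 * d ^ 6 * v ^ 2 + 5816 * d ^ 7 * v ^ 2 * s + 57760 * d ^ 5 * v ^ 3
    + 5176 * d ^ 6 * v ^ 3 * s + 112040 * d ^ 4 * v ^ 4 - 9304 * d ^ 5 * v ^ 4 * s
    + 120640 * d ^ 3 * v ^ 5 - 30776 * d ^ 4 * v ^ 5 * s + 65440 * d ^ 2 * v ^ 6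
    - 68096 * d ^ 3 * v ^ 6 * s + 13440 * d * v ^ 7 - 68256 * d ^ 2 * v ^ 7 * s
    + 8064 * d * v ^ 8 * s

/-- The rescaled scalar product at level `5`. -/
def scaledCrossFive (v s d : K) : K :=
  64 * d ^ 8 + 512 * d ^ 9 * s + 1024 * d ^ 7 * v + 5376 * d ^ 8 * v * s + 6704 * d ^ 6 * v ^ 2
    + 16736 * d ^ 7 * v ^ 2 * s + 23104 * d ^ 5 * v ^ 3 + 976 * d ^ 6 * v ^ 3 * s
    + 44816 * d ^ 4 * v ^ 4 - 71968 * d ^ 5 * v ^ 4 * s + 48256 * d ^ 3 * v ^ 5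
    - 87056 * d ^ 4 * v ^ 5 * s + 26176 * d ^ 2 * v ^ 6 - 14016 * d ^ 3 * v ^ 6 * s
    + 5376 * d * v ^ 7 - 11456 * d ^ 2 * v ^ 7 * s + 5376 * d * v ^ 8 * s

/-- The rescaled second norm at level `5`. -/
def scaledNormFive' (v s d : K) : K :=
  16 * d ^ 8 + 176 * d ^ 9 * s + 384 * d ^ 10 * s ^ 2 + 176 * d ^ 7 * v + 1568 * d ^ 8 * v * s
    + 2000 * d ^ 9 * v * s ^ 2 + 756 * d ^ 6 * v ^ 2 + 4948 * d ^ 7 * v ^ 2 * s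
    + 776 * d ^ 8 * v ^ 2 * s ^ 2 + 1656 * d ^ 5 * v ^ 3 + 7808 * d ^ 6 * v ^ 3 * s
    - 2064 * d ^ 7 * v ^ 3 * s ^ 2 + 2004 * d ^ 4 * v ^ 4 + 10996 * d ^ 5 * v ^ 4 * s
    + 8008 * d ^ 6 * v ^ 4 * s ^ 2 + 1344 * d ^ 3 * v ^ 5 + 19592 * d ^ 4 * v ^ 5 * s
    - 20464 * d ^ 5 * v ^ 5 * s ^ 2 + 464 * d ^ 2 * v ^ 6 + 23312 * d ^ 3 * v ^ 6 * s
    - 69056 * d ^ 4 * v ^ 6 * s ^ 2 + 64 * d * v ^ 7 + 13152 * d ^ 2 * v ^ 7 * s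
    - 14016 * d ^ 3 * v ^ 7 * s ^ 2 + 2688 * d * v ^ 8 * s + 128 * d ^ 2 * v ^ 8 * s ^ 2
    + 3584 * d * v ^ 9 * s ^ 2

/-- The rescaled second norm at level `4`. -/
def scaledNormFour' (v s d : K) : K :=
  2 * d ^ 2 * scaledNormTwo v s d ^ 2 + v * excessNormFour v s d

/-- The rescaled second vertex at level `4`. -/
def scaledVertexFour' (v d e : K) : K :=
  d * scaledVertexTwo v d e ^ 2 + v * excessVertexFour v d e

/-- The rescaled determinant at level `4`. -/
def scaledDetFour (v s d : K) : K :=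
  scaledNormFour v s d * scaledNormFour' v s d - v * s * scaledCrossFour v s d ^ 2

/-- The rescaled determinant at level `5`. -/
def scaledDetFive (v s d : K) : K :=
  scaledNormFive v s d * scaledNormFive' v s d - v * s * scaledCrossFive v s d ^ 2

end

variable {K : Type*} [Field K]

/-- The rescaled connected contribution of level `4`. -/
def connectedFour (v s d e : K) : K :=
  (2 * scaledNormTwo v s d ^ 2 * (s * scaledVertexFour v d e ^ 2 * scaledNormFour' v s d
      - 2 * s ^ 2 * scaledVertexFour v d e * scaledVertexFour' v d e * scaledCrossFour v s d)
    + s ^ 2 * scaledNormFour v s d *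
      (2 * scaledNormTwo v s d ^ 2 * (2 * d * scaledVertexTwo v d e ^ 2 * excessVertexFour v d e
        + v * excessVertexFour v d e ^ 2) - scaledVertexTwo v d e ^ 4 * excessNormFour v s d)
    + s ^ 3 * scaledVertexTwo v d e ^ 4 * scaledCrossFour v s d ^ 2)
  / (2 * scaledNormTwo v s d ^ 2 * scaledDetFour v s d)

variable {v s : K}

theorem vertexTwo_scaled (hv : v ≠ 0) (d e : K) :
    vertexTwo (e / v) (d / v) = scaledVertexTwo v d e / v ^ 2 := by
  rw [vertexTwo, scaledVertexTwo]
  field_simp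
  ring

theorem vertexFour_scaled (hv : v ≠ 0) (d e : K) :
    vertexFour (e / v) (d / v) = scaledVertexFour v d e / v ^ 4 := by
  rw [vertexFour, scaledVertexFour]
  field_simp
  ring

theorem vertexFour'_scaled (hv : v ≠ 0) (d e : K) :
    vertexFour' (e / v) (d / v) = scaledVertexFour' v d e / v ^ 5 := by
  rw [vertexFour', scaledVertexFour', scaledVertexTwo, excessVertexFour]
  field_simp
  ring

theorem normTwo_scaled (hv : v ≠ 0) (hs : s ≠ 0) (d : K) :
    normTwo (v * s)⁻¹ (d / v) = scaledNormTwo v s d / (v ^ 3 * s) := by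
  rw [normTwo, scaledNormTwo]
  field_simp
  ring

theorem normThree_scaled (hv : v ≠ 0) (hs : s ≠ 0) (d : K) :
    normThree (v * s)⁻¹ (d / v) = scaledNormThree v s d / (v ^ 5 * s) := by
  rw [normThree, scaledNormThree]
  field_simp
  ring

theorem normFour_scaled (hv : v ≠ 0) (hs : s ≠ 0) (d : K) :
    normFour (v * s)⁻¹ (d / v) = scaledNormFour v s d / (v ^ 7 * s) := by
  rw [normFour, scaledNormFour]
  field_simp
  ring

theorem crossFour_scaled (hv : v ≠ 0) (hs : s ≠ 0) (d : K) :
    crossFour (v * s)⁻¹ (d / v) = scaledCrossFour v s d / (v ^ 7 * s) := by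
  rw [crossFour, scaledCrossFour]
  field_simp
  ring

/-- Up to a multiple of `v` the rescaled norm is `2 d²` times the square of the level-2 norm, and
`vertexFour'_scaled` similarly has leading part `d` times a square. These factorizations drive the
cancellation in `ampFour_sub_scaled`. -/
theorem normFour'_scaled (hv : v ≠ 0) (hs : s ≠ 0) (d : K) :
    normFour' (v * s)⁻¹ (d / v) = scaledNormFour' v s d / (v ^ 8 * s ^ 2) := by
  rw [normFour', scaledNormFour', scaledNormTwo, excessNormFour]
  field_simp
  ring

theorem normFive_scaled (hv : v ≠ 0) (hs : s ≠ 0) (d : K) :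
    normFive (v * s)⁻¹ (d / v) = scaledNormFive v s d / (v ^ 9 * s) := by
  rw [normFive, scaledNormFive]
  field_simp
  ring

theorem crossFive_scaled (hv : v ≠ 0) (hs : s ≠ 0) (d : K) :
    crossFive (v * s)⁻¹ (d / v) = scaledCrossFive v s d / (v ^ 9 * s) := by
  rw [crossFive, scaledCrossFive]
  field_simp
  ring

theorem normFive'_scaled (hv : v ≠ 0) (hs : s ≠ 0) (d : K) :
    normFive' (v * s)⁻¹ (d / v) = scaledNormFive' v s d / (v ^ 10 * s ^ 2) := by
  rw [normFive', scaledNormFive']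
  field_simp
  ring

theorem detFour_scaled (hv : v ≠ 0) (hs : s ≠ 0) (d : K) :
    detFour (v * s)⁻¹ (d / v) = scaledDetFour v s d / (v ^ 15 * s ^ 3) := by
  rw [detFour, scaledDetFour, normFour_scaled hv hs, normFour'_scaled hv hs, crossFour_scaled hv hs]
  field_simp

theorem detFive_scaled (hv : v ≠ 0) (hs : s ≠ 0) (d : K) :
    detFive (v * s)⁻¹ (d / v) = scaledDetFive v s d / (v ^ 19 * s ^ 3) := by
  rw [detFive, scaledDetFive, normFive_scaled hv hs, normFive'_scaled hv hs, crossFive_scaled hv hs]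
  field_simp

theorem ampTwo_scaled (hv : v ≠ 0) (hs : s ≠ 0) (d e : K) :
    ampTwo (v * s)⁻¹ (e / v) (d / v) =
      s * scaledVertexTwo v d e ^ 2 / scaledNormTwo v s d / v := by
  rw [ampTwo, vertexTwo_scaled hv, normTwo_scaled hv hs]
  field_simp

/-- Exponentiation: the `v⁻²` part of `ampFour` is `(d V²)² / (2 d² N²)`, times `s²`, with `V` and
`N` the rescaled level-2 vertex and norm. This is exactly half the square of `ampTwo`. What remains
involves the excess terms and the cross norm, with only one power of `v` below. -/
theorem ampFour_sub_scaled [CharZero K] (hv : v ≠ 0) (hs : s ≠ 0) {d e : K}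
    (hN : scaledNormTwo v s d ≠ 0) (hD : scaledDetFour v s d ≠ 0) :
    ampFour (v * s)⁻¹ (e / v) (d / v) - ampTwo (v * s)⁻¹ (e / v) (d / v) ^ 2 / 2 =
      connectedFour v s d e / v := by
  rw [ampTwo_scaled hv hs, ampFour, detFour_scaled hv hs, normFour_scaled hv hs,
    normFour'_scaled hv hs, crossFour_scaled hv hs, vertexFour_scaled hv, vertexFour'_scaled hv,
    connectedFour]
  have hD' : scaledDetFour v s d = scaledNormFour v s d * scaledNormFour' v s d
    - v * s * scaledCrossFour v s d ^ 2 := rfl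
  field_simp
  rw [hD', scaledNormFour', scaledVertexFour']
  ring

end Scaling

/-! ### Expansions with coefficients independent of `α` -/

section Limits

/-- A family of series which, for all `α`, is expanded by the same coefficients, with leading
coefficient `r`. -/
def HasLimit (x : ℚ → LargeC) (r : ℝ) : Prop :=
  ∃ a b, PowerSeries.constantCoeff a = r ∧ ∀ α, 0 < α → α < 1 → Expands α (x α) a b

namespace HasLimit

variable {x y : ℚ → LargeC} {r t : ℝ}

theorem of_eq (hx : HasLimit x r) (h : r = t) : HasLimit x t := h ▸ hx

theorem congr (hx : HasLimit x r) (h : ∀ α, 0 < α → α < 1 → y α = x α) : HasLimit y r := by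
  obtain ⟨a, b, ha, hab⟩ := hx
  exact ⟨a, b, ha, fun α h0 h1 => h α h0 h1 ▸ hab α h0 h1⟩

theorem const (r : ℝ) : HasLimit (fun _ => HahnSeries.C r) r :=
  ⟨_, _, by simp, fun _ _ _ => Expands.const r⟩

theorem ofNat (n : ℕ) [n.AtLeastTwo] : HasLimit (fun _ => OfNat.ofNat n) (OfNat.ofNat n) := by
  simpa only [map_ofNat] using const (OfNat.ofNat n)

theorem smallV : HasLimit smallV 0 :=
  ⟨_, _, by simp, fun _ _ _ => Expands.smallV⟩

theorem smallS : HasLimit smallS 0 :=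
  ⟨_, _, by simp, fun _ _ h1 => Expands.smallS h1⟩

theorem add (hx : HasLimit x r) (hy : HasLimit y t) : HasLimit (fun α => x α + y α) (r + t) := by
  obtain ⟨a, b, rfl, h⟩ := hx
  obtain ⟨a', b', rfl, h'⟩ := hy
  exact ⟨_, _, by simp, fun α h0 h1 => (h α h0 h1).add (h' α h0 h1)⟩

theorem sub (hx : HasLimit x r) (hy : HasLimit y t) : HasLimit (fun α => x α - y α) (r - t) := by
  obtain ⟨a, b, rfl, h⟩ := hx
  obtain ⟨a', b', rfl, h'⟩ := hy
  exact ⟨_, _, by simp, fun α h0 h1 => (h α h0 h1).sub (h' α h0 h1)⟩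

theorem mul (hx : HasLimit x r) (hy : HasLimit y t) : HasLimit (fun α => x α * y α) (r * t) := by
  obtain ⟨a, b, rfl, h⟩ := hx
  obtain ⟨a', b', rfl, h'⟩ := hy
  exact ⟨_, _, by simp, fun α h0 h1 => (h α h0 h1).mul h0 h1 (h' α h0 h1)⟩

theorem pow (hx : HasLimit x r) (n : ℕ) : HasLimit (fun α => x α ^ n) (r ^ n) := by
  induction n with
  | zero => simpa using const 1
  | succ n ih => simpa only [pow_succ] using ih.mul hx

theorem div (hx : HasLimit x r) (hy : HasLimit y t) (ht : t ≠ 0) :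
    HasLimit (fun α => x α / y α) (r / t) := by
  obtain ⟨a, b, rfl, h⟩ := hx
  obtain ⟨a', b', rfl, h'⟩ := hy
  exact ⟨_, _, by simp [div_eq_mul_inv],
    fun α h0 h1 => (h α h0 h1).div h0 h1 (h' α h0 h1) ht⟩

theorem ne_zero (hx : HasLimit x r) (hr : r ≠ 0) {α : ℚ} (h0 : 0 < α) (h1 : α < 1) :
    x α ≠ 0 := by
  obtain ⟨a, b, rfl, h⟩ := hx
  exact (h α h0 h1).ne_zero h0 h1 hr

end HasLimit

/-- The rescaled polynomials are defined over any commutative ring, so they can be formed in `ℝ[v,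
s]` and then evaluated. One induction therefore covers all of them. -/
theorem hasLimit_eval₂ (p : MvPolynomial (Fin 2) ℝ) :
    HasLimit (fun α => MvPolynomial.eval₂ HahnSeries.C ![smallV α, smallS α] p)
      (MvPolynomial.eval ![0, 0] p) := by
  induction p using MvPolynomial.induction_on with
  | C a => simpa using HasLimit.const a
  | add p q hp hq => simpa using hp.add hq
  | mul_X p i hp =>
    fin_cases i
    · simpa using hp.mul HasLimit.smallV
    · simpa using hp.mul HasLimit.smallS

open MvPolynomial (X C)

theorem hasLimit_scaledVertexTwo (d e : ℝ) :
    HasLimit (fun α => scaledVertexTwo (smallV α) (HahnSeries.C d) (HahnSeries.C e))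
      (scaledVertexTwo 0 d e) := by
  refine ((hasLimit_eval₂ (scaledVertexTwo (X 0) (C d) (C e))).of_eq ?_).congr ?_ <;>
    simp [scaledVertexTwo]

theorem hasLimit_scaledVertexFour (d e : ℝ) :
    HasLimit (fun α => scaledVertexFour (smallV α) (HahnSeries.C d) (HahnSeries.C e))
      (scaledVertexFour 0 d e) := by
  refine ((hasLimit_eval₂ (scaledVertexFour (X 0) (C d) (C e))).of_eq ?_).congr ?_ <;>
    simp [scaledVertexFour]

theorem hasLimit_scaledVertexFour' (d e : ℝ) :
    HasLimit (fun α => scaledVertexFour' (smallV α) (HahnSeries.C d) (HahnSeries.C e))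
      (scaledVertexFour' 0 d e) := by
  refine ((hasLimit_eval₂ (scaledVertexFour' (X 0) (C d) (C e))).of_eq ?_).congr ?_ <;>
    simp [scaledVertexFour', scaledVertexTwo, excessVertexFour]

theorem hasLimit_excessVertexFour (d e : ℝ) :
    HasLimit (fun α => excessVertexFour (smallV α) (HahnSeries.C d) (HahnSeries.C e))
      (excessVertexFour 0 d e) := by
  refine ((hasLimit_eval₂ (excessVertexFour (X 0) (C d) (C e))).of_eq ?_).congr ?_ <;>
    simp [excessVertexFour]

theorem hasLimit_scaledNormTwo (d : ℝ) :
    HasLimit (fun α => scaledNormTwo (smallV α) (smallS α) (HahnSeries.C d))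
      (scaledNormTwo 0 0 d) := by
  refine ((hasLimit_eval₂ (scaledNormTwo (X 0) (X 1) (C d))).of_eq ?_).congr ?_ <;>
    simp [scaledNormTwo]

theorem hasLimit_scaledNormThree (d : ℝ) :
    HasLimit (fun α => scaledNormThree (smallV α) (smallS α) (HahnSeries.C d))
      (scaledNormThree 0 0 d) := by
  refine ((hasLimit_eval₂ (scaledNormThree (X 0) (X 1) (C d))).of_eq ?_).congr ?_ <;>
    simp [scaledNormThree]

theorem hasLimit_scaledNormFour (d : ℝ) :
    HasLimit (fun α => scaledNormFour (smallV α) (smallS α) (HahnSeries.C d))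
      (scaledNormFour 0 0 d) := by
  refine ((hasLimit_eval₂ (scaledNormFour (X 0) (X 1) (C d))).of_eq ?_).congr ?_ <;>
    simp [scaledNormFour]

theorem hasLimit_scaledCrossFour (d : ℝ) :
    HasLimit (fun α => scaledCrossFour (smallV α) (smallS α) (HahnSeries.C d))
      (scaledCrossFour 0 0 d) := by
  refine ((hasLimit_eval₂ (scaledCrossFour (X 0) (X 1) (C d))).of_eq ?_).congr ?_ <;>
    simp [scaledCrossFour]

theorem hasLimit_scaledNormFour' (d : ℝ) :
    HasLimit (fun α => scaledNormFour' (smallV α) (smallS α) (HahnSeries.C d))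
      (scaledNormFour' 0 0 d) := by
  refine ((hasLimit_eval₂ (scaledNormFour' (X 0) (X 1) (C d))).of_eq ?_).congr ?_ <;>
    simp [scaledNormFour', scaledNormTwo, excessNormFour]

theorem hasLimit_excessNormFour (d : ℝ) :
    HasLimit (fun α => excessNormFour (smallV α) (smallS α) (HahnSeries.C d))
      (excessNormFour 0 0 d) := by
  refine ((hasLimit_eval₂ (excessNormFour (X 0) (X 1) (C d))).of_eq ?_).congr ?_ <;>
    simp [excessNormFour]

theorem hasLimit_scaledDetFour (d : ℝ) :
    HasLimit (fun α => scaledDetFour (smallV α) (smallS α) (HahnSeries.C d))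
      (scaledDetFour 0 0 d) := by
  refine ((hasLimit_eval₂ (scaledDetFour (X 0) (X 1) (C d))).of_eq ?_).congr ?_ <;>
    simp [scaledDetFour, scaledNormFour, scaledCrossFour, scaledNormFour',
    scaledNormTwo, excessNormFour]

theorem hasLimit_scaledDetFive (d : ℝ) :
    HasLimit (fun α => scaledDetFive (smallV α) (smallS α) (HahnSeries.C d))
      (scaledDetFive 0 0 d) := by
  refine ((hasLimit_eval₂ (scaledDetFive (X 0) (X 1) (C d))).of_eq ?_).congr ?_ <;>
    simp [scaledDetFive, scaledNormFive, scaledCrossFive, scaledNormFive']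

theorem cMonomial_one_eq (α : ℚ) : cMonomial 1 1 = (smallV α * smallS α)⁻¹ := by
  rw [smallV, smallS, HahnSeries.single_mul_single, HahnSeries.inv_single, cMonomial]
  norm_num

theorem cMonomial_eq (α : ℚ) (x : ℝ) : cMonomial α x = HahnSeries.C x / smallV α := by
  rw [smallV, HahnSeries.C_apply, HahnSeries.single_div_single, cMonomial]
  norm_num

theorem smallV_ne_zero (α : ℚ) : smallV α ≠ 0 := by
  simp [smallV]

theorem smallS_ne_zero (α : ℚ) : smallS α ≠ 0 := by
  simp [smallS]

/-- After clearing powers of `v` and `s`, each quantity tends to a nonzero multiple of a power of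
`d` at `v = s = 0`. A series with nonzero leading coefficient is nonzero. -/
theorem nondegenerate {α : ℚ} (h0 : 0 < α) (h1 : α < 1) {d : ℝ} (hd : d ≠ 0) :
    Nondegenerate (smallV α * smallS α)⁻¹ (HahnSeries.C d / smallV α) := by
  have hv := smallV_ne_zero α
  have hs := smallS_ne_zero α
  have one : HasLimit (fun _ => 1) 1 := by simpa using HasLimit.const 1
  have lin : ∀ {m n : ℚ → LargeC} {r t : ℝ}, HasLimit m r → HasLimit n t → r ≠ 0 →
      m α * (HahnSeries.C d / smallV α) + n α ≠ 0 := by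
    intro m n r t hm hn hr
    have h2 : m α * (HahnSeries.C d / smallV α) + n α =
      (m α * HahnSeries.C d + n α * smallV α) / smallV α := by field_simp
    rw [h2]
    refine div_ne_zero (HasLimit.ne_zero
      ((hm.mul (HasLimit.const d)).add (hn.mul HasLimit.smallV)) ?_ h0 h1) hv
    simpa using ⟨hr, hd⟩
  have lin1 : ∀ {n : ℚ → LargeC} {t : ℝ}, HasLimit n t →
      HahnSeries.C d / smallV α + n α ≠ 0 := by
    intro n t hn
    simpa using lin one hn one_ne_zero
  have two : HasLimit (fun _ => 2) 2 := HasLimit.ofNat _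
  have three : HasLimit (fun _ => 3) 3 := HasLimit.ofNat _
  have four : HasLimit (fun _ => 4) 4 := HasLimit.ofNat _
  have five : HasLimit (fun _ => 5) 5 := HasLimit.ofNat _
  have seven : HasLimit (fun _ => 7) 7 := HasLimit.ofNat _
  constructor
  · exact div_ne_zero (by simpa using hd) hv
  · exact lin1 one
  · exact lin1 two
  · exact lin1 three
  · exact lin1 four
  · exact lin (m := fun _ => 2) (n := fun _ => 1) two one two_ne_zero
  · exact lin (m := fun _ => 2) (n := fun _ => 3) two three two_ne_zero
  · exact lin (m := fun _ => 2) (n := fun _ => 5) two five two_ne_zero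
  · exact lin (m := fun _ => 2) (n := fun _ => 7) two seven two_ne_zero
  · rw [normTwo_scaled hv hs]
    exact div_ne_zero ((hasLimit_scaledNormTwo d).ne_zero
      (by simp [scaledNormTwo, hd]) h0 h1) (by simp [hv, hs])
  · rw [normThree_scaled hv hs]
    exact div_ne_zero ((hasLimit_scaledNormThree d).ne_zero
      (by simp [scaledNormThree, hd]) h0 h1) (by simp [hv, hs])
  · rw [detFour_scaled hv hs]
    exact div_ne_zero ((hasLimit_scaledDetFour d).ne_zero
      (by simp [scaledDetFour, scaledNormFour, scaledNormFour', scaledNormTwo, hd]) h0 h1)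
      (by simp [hv, hs])
  · rw [detFive_scaled hv hs]
    exact div_ne_zero ((hasLimit_scaledDetFive d).ne_zero
      (by simp [scaledDetFive, scaledNormFive, scaledNormFive', hd]) h0 h1) (by simp [hv, hs])

/-- The denominator is nonzero at `v = s = 0` and contains no factor `v`. The value of the limit is
never used, only its existence with coefficients common to all `α`. -/
theorem hasLimit_connectedFour {d : ℝ} (hd : d ≠ 0) (e : ℝ) :
    ∃ r, HasLimit (fun α =>
      connectedFour (smallV α) (smallS α) (HahnSeries.C d) (HahnSeries.C e)) r := by
  have v := HasLimit.smallV
  have s := HasLimit.smallS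
  have two : HasLimit (fun _ => 2) 2 := HasLimit.ofNat _
  have D := HasLimit.const d
  have n2 := hasLimit_scaledNormTwo d
  have c2 := hasLimit_scaledVertexTwo d e
  have ga := hasLimit_scaledVertexFour d e
  have gb := hasLimit_scaledVertexFour' d e
  have baa := hasLimit_scaledNormFour d
  have bab := hasLimit_scaledCrossFour d
  have bbb := hasLimit_scaledNormFour' d
  have r1 := hasLimit_excessVertexFour d e
  have q1 := hasLimit_excessNormFour d
  have t1 := (two.mul (n2.pow 2)).mul
    (((s.mul (ga.pow 2)).mul bbb).sub ((((two.mul (s.pow 2)).mul ga).mul gb).mul bab))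
  have t2 := ((s.pow 2).mul baa).mul (((two.mul (n2.pow 2)).mul
    ((((two.mul D).mul (c2.pow 2)).mul r1).add (v.mul (r1.pow 2)))).sub ((c2.pow 4).mul q1))
  have t3 := ((s.pow 3).mul (c2.pow 4)).mul (bab.pow 2)
  have t4 := (two.mul (n2.pow 2)).mul (hasLimit_scaledDetFour d)
  refine ⟨_, ((t1.add t2).add t3).div t4 ?_⟩
  simp [scaledDetFour, scaledNormFour, scaledNormFour', scaledNormTwo, hd]

end Limits

/-! ### The rescaled logarithmic block -/

section LogBlock

open PowerSeries (coeff)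

theorem logBlock_eq (α : ℚ) (p : ClassicalDims) :
    logBlock α p = PowerSeries.logOf (block (smallV α * smallS α)⁻¹
      (HahnSeries.C p.1 / smallV α) (HahnSeries.C (p.2 : ℝ) / smallV α)) := by
  rw [logBlock, cMonomial_one_eq α, cMonomial_eq, cMonomial_eq]

section Scaled

variable {K : Type*} [Field K] [Algebra ℚ K] {v s d e : K}

theorem mul_coeff_two_log_block (hv : v ≠ 0) (hs : s ≠ 0)
    (hnd : Nondegenerate (v * s)⁻¹ (d / v)) :
    v * coeff 2 (PowerSeries.logOf (block (v * s)⁻¹ (e / v) (d / v))) =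
      d * (3 * d + 2 * v) / (8 * (2 * d + v))
        + s * scaledVertexTwo v d e ^ 2 / scaledNormTwo v s d := by
  rw [coeff_two_log_block hnd, ampTwo_scaled hv hs, mul_add, mul_div_cancel₀ _ hv]
  congr 1
  field_simp

theorem mul_coeff_three_log_block (hv : v ≠ 0) (hs : s ≠ 0)
    (hnd : Nondegenerate (v * s)⁻¹ (d / v)) :
    v * coeff 3 (PowerSeries.logOf (block (v * s)⁻¹ (e / v) (d / v))) =
      d * (5 * d + 4 * v) / (24 * (2 * d + v))
        + s * scaledVertexTwo v d e ^ 2 / scaledNormTwo v s d := by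
  rw [coeff_three_log_block hnd, ampTwo_scaled hv hs, mul_add, mul_div_cancel₀ _ hv]
  congr 1
  field_simp

theorem mul_coeff_four_log_block (hv : v ≠ 0) (hs : s ≠ 0)
    (hnd : Nondegenerate (v * s)⁻¹ (d / v)) (hN : scaledNormTwo v s d ≠ 0)
    (hD : scaledDetFour v s d ≠ 0) :
    v * coeff 4 (PowerSeries.logOf (block (v * s)⁻¹ (e / v) (d / v))) =
      d * (35 * d ^ 3 + 102 * d ^ 2 * v + 90 * d * v ^ 2 + 24 * v ^ 3)
          / (64 * (2 * d + v) ^ 2 * (2 * d + 3 * v))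
        + s * scaledVertexTwo v d e ^ 2 / scaledNormTwo v s d *
          ((7 * d ^ 2 + 21 * d * v + 9 * v ^ 2) / (2 * (2 * d + v) * (2 * d + 5 * v)))
        + connectedFour v s d e := by
  have := algebraRat.charZero K
  rw [coeff_four_log_block hnd, ampFour_sub_scaled hv hs hN hD, ampTwo_scaled hv hs, mul_add,
    mul_add, mul_div_cancel₀ _ hv, ← mul_assoc v, mul_div_cancel₀ _ hv]
  congr 2
  · field_simp
  · congr 1
    field_simp

theorem mul_coeff_five_log_block (hv : v ≠ 0) (hs : s ≠ 0)
    (hnd : Nondegenerate (v * s)⁻¹ (d / v)) (hN : scaledNormTwo v s d ≠ 0)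
    (hD : scaledDetFour v s d ≠ 0) :
    v * coeff 5 (PowerSeries.logOf (block (v * s)⁻¹ (e / v) (d / v))) =
      d * (63 * d ^ 3 + 190 * d ^ 2 * v + 174 * d * v ^ 2 + 48 * v ^ 3)
          / (160 * (2 * d + v) ^ 2 * (2 * d + 3 * v))
        + s * scaledVertexTwo v d e ^ 2 / scaledNormTwo v s d *
          ((3 * d ^ 2 + 9 * d * v + 4 * v ^ 2) / ((2 * d + v) * (2 * d + 5 * v)))
        + 2 * connectedFour v s d e := by
  have := algebraRat.charZero K
  rw [coeff_five_log_block hnd, ampFour_sub_scaled hv hs hN hD, ampTwo_scaled hv hs, mul_add,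
    mul_add, mul_left_comm v 2, mul_div_cancel₀ _ hv, ← mul_assoc v, mul_div_cancel₀ _ hv]
  congr 2
  · field_simp
  · congr 1
    field_simp

end Scaled

/-- Every ingredient is built from `v`, `s` and constants by sums, products and quotients whose
denominators tend to a nonzero number. `HasLimit` chooses the expansion before `α`, which is the
source of all independence of `α`. -/
theorem exists_hasLimit (p : ClassicalDims) (n : ℕ) (hn : n < 6) :
    ∃ r, HasLimit (fun α => smallV α * coeff n (logBlock α p)) r := by
  obtain ⟨e, d, hd⟩ := p
  have v := HasLimit.smallV
  have s := HasLimit.smallS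
  have D := HasLimit.const d
  have num : ∀ (k : ℕ) [k.AtLeastTwo], HasLimit (fun _ => OfNat.ofNat k) (OfNat.ofNat k) :=
    fun k _ => HasLimit.ofNat k
  have nd : ∀ α, 0 < α → α < 1 → Nondegenerate (smallV α * smallS α)⁻¹
      (HahnSeries.C d / smallV α) := fun α h0 h1 => nondegenerate h0 h1 hd
  have hN : ∀ α, 0 < α → α < 1 → scaledNormTwo (smallV α) (smallS α) (HahnSeries.C d) ≠ 0 :=
    fun α h0 h1 => (hasLimit_scaledNormTwo d).ne_zero (by simp [scaledNormTwo, hd]) h0 h1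
  have hD : ∀ α, 0 < α → α < 1 → scaledDetFour (smallV α) (smallS α) (HahnSeries.C d) ≠ 0 :=
    fun α h0 h1 => (hasLimit_scaledDetFour d).ne_zero
      (by simp [scaledDetFour, scaledNormFour, scaledNormFour', scaledNormTwo, hd]) h0 h1
  have amp := (s.mul ((hasLimit_scaledVertexTwo d e).pow 2)).div (hasLimit_scaledNormTwo d)
    (by simp [scaledNormTwo, hd])
  obtain ⟨r, conn⟩ := hasLimit_connectedFour hd e
  have l1 : HasLimit (fun α => 2 * HahnSeries.C d + smallV α) (2 * d) :=
    (((num _).mul D).add v).of_eq (by simp)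
  have l3 : HasLimit (fun α => 2 * HahnSeries.C d + 3 * smallV α) (2 * d) :=
    (((num _).mul D).add ((num _).mul v)).of_eq (by simp)
  have l5 : HasLimit (fun α => 2 * HahnSeries.C d + 5 * smallV α) (2 * d) :=
    (((num _).mul D).add ((num _).mul v)).of_eq (by simp)
  have low : ∀ (k m n : ℕ) [k.AtLeastTwo] [m.AtLeastTwo] [n.AtLeastTwo], HasLimit (fun α =>
      HahnSeries.C d * (OfNat.ofNat k * HahnSeries.C d + OfNat.ofNat m * smallV α)
        / (OfNat.ofNat n * (2 * HahnSeries.C d + smallV α))) _ := fun k m n _ _ _ =>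
    (D.mul (((num k).mul D).add ((num m).mul v))).div ((num n).mul l1)
      (mul_ne_zero (OfNat.ofNat_ne_zero n) (mul_ne_zero two_ne_zero hd))
  have high : ∀ (k₀ k₁ k₂ k₃ n : ℕ) [k₀.AtLeastTwo] [k₁.AtLeastTwo] [k₂.AtLeastTwo]
      [k₃.AtLeastTwo] [n.AtLeastTwo], HasLimit (fun α => HahnSeries.C d *
        (OfNat.ofNat k₀ * HahnSeries.C d ^ 3 + OfNat.ofNat k₁ * HahnSeries.C d ^ 2 * smallV α
          + OfNat.ofNat k₂ * HahnSeries.C d * smallV α ^ 2 + OfNat.ofNat k₃ * smallV α ^ 3)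
        / (OfNat.ofNat n * (2 * HahnSeries.C d + smallV α) ^ 2
          * (2 * HahnSeries.C d + 3 * smallV α))) _ := fun k₀ k₁ k₂ k₃ n _ _ _ _ _ =>
    (D.mul (((((num k₀).mul (D.pow 3)).add (((num k₁).mul (D.pow 2)).mul v)).add
      (((num k₂).mul D).mul (v.pow 2))).add ((num k₃).mul (v.pow 3)))).div
      (((num n).mul (l1.pow 2)).mul l3) (by simp [hd])
  have quad : ∀ (k₀ k₁ k₂ : ℕ) [k₀.AtLeastTwo] [k₁.AtLeastTwo] [k₂.AtLeastTwo],
      HasLimit (fun α => OfNat.ofNat k₀ * HahnSeries.C d ^ 2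
        + OfNat.ofNat k₁ * HahnSeries.C d * smallV α + OfNat.ofNat k₂ * smallV α ^ 2) _ :=
    fun k₀ k₁ k₂ _ _ _ => (((num k₀).mul (D.pow 2)).add (((num k₁).mul D).mul v)).add
      ((num k₂).mul (v.pow 2))
  interval_cases n
  · refine ⟨0, (HasLimit.const 0).congr fun α h0 h1 => ?_⟩
    rw [logBlock_eq, PowerSeries.coeff_zero_eq_constantCoeff_apply,
      PowerSeries.constantCoeff_logOf, mul_zero, map_zero]
    rw [← PowerSeries.coeff_zero_eq_constantCoeff_apply, block, PowerSeries.coeff_mk,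
      blockCoeff_zero]
  · refine ⟨_, (D.div (num 2) two_ne_zero).congr fun α h0 h1 => ?_⟩
    rw [logBlock_eq, coeff_one_log_block (nd α h0 h1), mul_div_assoc',
      mul_div_cancel₀ _ (smallV_ne_zero α)]
  · refine ⟨_, ((low 3 2 8).add amp).congr fun α h0 h1 => ?_⟩
    rw [logBlock_eq, mul_coeff_two_log_block (smallV_ne_zero α) (smallS_ne_zero α) (nd α h0 h1)]
  · refine ⟨_, ((low 5 4 24).add amp).congr fun α h0 h1 => ?_⟩
    rw [logBlock_eq, mul_coeff_three_log_block (smallV_ne_zero α) (smallS_ne_zero α) (nd α h0 h1)]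
  · refine ⟨_, (((high 35 102 90 24 64).add (amp.mul ((quad 7 21 9).div
      (((num 2).mul l1).mul l5) (by simp [hd])))).add conn).congr fun α h0 h1 => ?_⟩
    rw [logBlock_eq, mul_coeff_four_log_block (smallV_ne_zero α) (smallS_ne_zero α) (nd α h0 h1)
      (hN α h0 h1) (hD α h0 h1)]
  · refine ⟨_, (((high 63 190 174 48 160).add (amp.mul ((quad 3 9 4).div
      (l1.mul l5) (by simp [hd])))).add ((num 2).mul conn)).congr fun α h0 h1 => ?_⟩
    rw [logBlock_eq, mul_coeff_five_log_block (smallV_ne_zero α) (smallS_ne_zero α) (nd α h0 h1)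
      (hN α h0 h1) (hD α h0 h1)]

end LogBlock

/-! ### Reading off the powers of `c` -/

section PrincipalPart

variable {α : ℚ}

theorem expo_eq (m : ℕ) (α : ℚ) : expo m α = 1 - m * (1 - α) := by
  rw [expo]; ring

theorem pos_of_mem_halfOpen {M : ℕ} (hM : 1 ≤ M) (hα : α ∈ halfOpen M) : 0 < α := by
  have h1 : (1 : ℚ) ≤ M := by exact_mod_cast hM
  exact (div_nonneg (by linarith) (by linarith)).trans_lt hα.1

theorem lt_one_of_mem_halfOpen {M : ℕ} (hα : α ∈ halfOpen M) : α < 1 := by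
  have h1 : (0 : ℚ) ≤ M := Nat.cast_nonneg M
  exact hα.2.trans_lt ((div_lt_one (by linarith)).2 (by linarith))

/-- Since `expo m α = 1 - m (1 - α)`, the interval is precisely the condition `1/(M+1) ≤ 1 - α <
1/M`. -/
theorem expo_pos_iff {M : ℕ} (hM : 1 ≤ M) (hα : α ∈ halfOpen M) (m : ℕ) :
    0 < expo m α ↔ m ≤ M := by
  have h1 : (1 : ℚ) ≤ M := by exact_mod_cast hM
  have h2 := (div_lt_iff₀ (by linarith)).1 hα.1
  have h3 := (le_div_iff₀ (by linarith)).1 hα.2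
  have h4 := lt_one_of_mem_halfOpen hα
  rw [expo_eq]
  constructor
  · intro h
    by_contra hm
    have h5 : (M : ℚ) + 1 ≤ m := by exact_mod_cast not_le.1 hm
    nlinarith
  · intro hm
    have h5 : (m : ℚ) ≤ M := by exact_mod_cast hm
    nlinarith

theorem expo_injective (h1 : α < 1) {m n : ℕ} (h : expo m α = expo n α) : m = n := by
  rw [expo_eq, expo_eq] at h
  have h2 : ((m : ℚ) - n) * (1 - α) = 0 := by linarith
  rcases mul_eq_zero.1 h2 with h3 | h3
  · exact_mod_cast sub_eq_zero.1 h3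
  · linarith

theorem regular_subset_halfOpen (M : ℕ) : regular M ⊆ halfOpen M := Set.Ioo_subset_Ioc_self

theorem exceptional_mem_halfOpen {M : ℕ} (hM : 1 ≤ M) : exceptional M ∈ halfOpen M := by
  have h1 : (1 : ℚ) ≤ M := by exact_mod_cast hM
  refine ⟨?_, le_rfl⟩
  rw [exceptional, div_lt_div_iff₀ (by linarith) (by linarith)]
  linarith

theorem expo_exceptional (M : ℕ) : expo (M + 1) (exceptional M) = 0 := by
  have h1 : (M : ℚ) + 1 ≠ 0 := by positivity
  rw [expo_eq, exceptional]
  push_cast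
  field_simp
  ring

theorem expo_ne_zero_of_mem_regular {M : ℕ} (hM : 1 ≤ M) (hα : α ∈ regular M) (m : ℕ) :
    expo m α ≠ 0 := by
  intro h
  have h1 : (1 : ℚ) ≤ M := by exact_mod_cast hM
  have h3 := (lt_div_iff₀ (by linarith)).1 hα.2
  have h4 := lt_one_of_mem_halfOpen (regular_subset_halfOpen M hα)
  have hm : ¬ m ≤ M := by
    rw [← expo_pos_iff hM (regular_subset_halfOpen M hα), h]
    exact lt_irrefl 0
  have h5 : (M : ℚ) + 1 ≤ m := by exact_mod_cast not_le.1 hm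
  rw [expo_eq] at h
  nlinarith

section Coefficient

variable {L : LargeC} {a : PowerSeries ℝ} {b : ℝ}

/-- Multiplication by `v` moves `c^x` to exponent `α - x` of `1/c`. For `x ≥ 0` this is at most `α`,
within the range that `Expands` controls. -/
theorem cCoeff_eq_of_expands (hE : Expands α (smallV α * L) a b) {x : ℚ} (hx : 0 ≤ x) :
    cCoeff x L = (evalS α a).coeff (α - x) + if x = 0 then b else 0 := by
  have h2 := hE.coeff_eq (e := -x + α) (by linarith)
  rw [smallV, HahnSeries.coeff_single_mul_add, one_mul] at h2
  rw [cCoeff, h2, neg_add_eq_sub]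
  simp

theorem cCoeff_expo (h1 : α < 1) (hE : Expands α (smallV α * L) a b) {k : ℕ}
    (hk : 0 < expo (k + 1) α) : cCoeff (expo (k + 1) α) L = PowerSeries.coeff k a := by
  have h2 : α - expo (k + 1) α = k * (1 - α) := by rw [expo_eq]; push_cast; ring
  rw [cCoeff_eq_of_expands hE hk.le, if_neg hk.ne', add_zero, h2, coeff_evalS h1]

theorem cCoeff_eq_zero (h1 : α < 1) (hE : Expands α (smallV α * L) a b) {x : ℚ} (hx : 0 < x)
    (hne : ∀ k : ℕ, x ≠ expo (k + 1) α) : cCoeff x L = 0 := by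
  rw [cCoeff_eq_of_expands hE hx.le, if_neg hx.ne', add_zero]
  refine coeff_evalS_of_ne h1 a fun k hk => hne k ?_
  rw [expo_eq]; push_cast; linarith

theorem cCoeff_zero_of_ne (h1 : α < 1) (hE : Expands α (smallV α * L) a b)
    (hne : ∀ k : ℕ, expo (k + 1) α ≠ 0) : cCoeff 0 L = b := by
  rw [cCoeff_eq_of_expands hE le_rfl, if_pos rfl, coeff_evalS_of_ne h1 a, zero_add]
  intro k hk
  refine hne k ?_
  rw [expo_eq]; push_cast; linarith

/-- The resonance: `expo (k+1) α = 0` means `k (1 - α) = α`, so `s^k` and `v` are the same power of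
`c` and their coefficients add. -/
theorem cCoeff_zero_of_eq (h1 : α < 1) (hE : Expands α (smallV α * L) a b) {k : ℕ}
    (hk : expo (k + 1) α = 0) : cCoeff 0 L = PowerSeries.coeff k a + b := by
  have h2 : α - 0 = k * (1 - α) := by rw [expo_eq] at hk; push_cast at hk; linarith
  rw [cCoeff_eq_of_expands hE le_rfl, if_pos rfl, h2, coeff_evalS h1]

theorem prin_eq {M : ℕ} (hM : 1 ≤ M) (hα : α ∈ halfOpen M)
    (hE : Expands α (smallV α * L) a b) :
    prin L = ∑ m ∈ Finset.Icc 1 M,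
        cMonomial (expo m α) 1 * HahnSeries.C (cCoeff (expo m α) L)
      + HahnSeries.C (cCoeff 0 L) := by
  have h1 := lt_one_of_mem_halfOpen hα
  have hterm : ∀ m : ℕ, cMonomial (expo m α) 1 * HahnSeries.C (cCoeff (expo m α) L) =
      HahnSeries.single (-expo m α) (cCoeff (expo m α) L) := by
    intro m
    rw [cMonomial, HahnSeries.C_apply, HahnSeries.single_mul_single, add_zero, one_mul]
  ext e
  rw [HahnSeries.coeff_add, HahnSeries.coeff_sum, HahnSeries.C_apply]
  simp only [hterm, HahnSeries.coeff_single]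
  change (if e ≤ 0 then L.coeff e else 0) = _
  rcases lt_trichotomy e 0 with he | rfl | he
  · rw [if_pos he.le, if_neg he.ne, add_zero]
    by_cases hex : ∃ m, 1 ≤ m ∧ -e = expo m α
    · obtain ⟨m, hm, hme⟩ := hex
      have hmM : m ≤ M := (expo_pos_iff hM hα m).1 (by linarith)
      rw [Finset.sum_eq_single m]
      · rw [if_pos (by linarith), ← hme, cCoeff, neg_neg]
      · intro n _ hn
        rw [if_neg]
        intro h
        exact hn (expo_injective h1 (by linarith))
      · intro h
        exact absurd (Finset.mem_Icc.2 ⟨hm, hmM⟩) h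
    · have h2 := cCoeff_eq_zero h1 hE (x := -e) (by linarith)
        fun k hk => hex ⟨k + 1, by omega, hk⟩
      rw [cCoeff, neg_neg] at h2
      rw [h2, Finset.sum_eq_zero]
      intro m hm
      rw [if_neg]
      intro h
      exact hex ⟨m, (Finset.mem_Icc.1 hm).1, by linarith⟩
  · rw [if_pos le_rfl, if_pos rfl, Finset.sum_eq_zero, zero_add, cCoeff, neg_zero]
    intro m hm
    have := (expo_pos_iff hM hα m).2 (Finset.mem_Icc.1 hm).2
    rw [if_neg (by linarith)]
  · rw [if_neg he.not_ge, if_neg he.ne', add_zero, Finset.sum_eq_zero]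
    intro m hm
    have := (expo_pos_iff hM hα m).2 (Finset.mem_Icc.1 hm).2
    rw [if_neg (by linarith)]

end Coefficient

theorem exists_expands (p : ClassicalDims) (n : ℕ) (hn : n < 6) :
    ∃ a b, ∀ α, 0 < α → α < 1 →
      Expands α (smallV α * PowerSeries.coeff n (logBlock α p)) a b := by
  obtain ⟨r, a, b, -, h⟩ := exists_hasLimit p n hn
  exact ⟨a, b, h⟩

theorem coeff_f (α x : ℚ) (p : ClassicalDims) (n : ℕ) :
    (f α x p).coeff n = if n < 6 then cCoeff x (PowerSeries.coeff n (logBlock α p)) else 0 := by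
  rw [f, PowerSeries.coeff_trunc, PowerSeries.coeff_mk]

theorem f_congr {α α' x x' : ℚ} (h : ∀ p n, n < 6 →
    cCoeff x (PowerSeries.coeff n (logBlock α p)) =
      cCoeff x' (PowerSeries.coeff n (logBlock α' p))) : f α x = f α' x' := by
  ext p n
  rw [coeff_f, coeff_f]
  split_ifs with hn
  exacts [h p n hn, rfl]

theorem prinLogBlock_eq {M : ℕ} (hM : 1 ≤ M) (hα : α ∈ halfOpen M) (p : ClassicalDims) :
    prinLogBlock α p =
      (∑ m ∈ Finset.Icc 1 M, Polynomial.C (cMonomial (expo m α) 1) *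
        (f α (expo m α) p).map (HahnSeries.C : ℝ →+* LargeC))
      + (f α 0 p).map (HahnSeries.C : ℝ →+* LargeC) := by
  ext1 n
  rw [prinLogBlock, PowerSeries.coeff_trunc, PowerSeries.coeff_mk, Polynomial.coeff_add,
    Polynomial.finsetSum_coeff]
  simp only [Polynomial.coeff_C_mul, Polynomial.coeff_map, coeff_f]
  split_ifs with hn
  · obtain ⟨a, b, h⟩ := exists_expands p n hn
    exact prin_eq hM hα (h α (pos_of_mem_halfOpen hM hα) (lt_one_of_mem_halfOpen hα))
  · simp

/-! ### The sample point separating the coefficient functions -/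

section UnitDimension

/-- Vanishing external dimensions, unit intermediate dimension. -/
def unitDims : ClassicalDims := (0, ⟨1, one_ne_zero⟩)

theorem expands_unitDims {α : ℚ} (h0 : 0 < α) (h1 : α < 1) :
    Expands α (smallV α * PowerSeries.coeff 2 (logBlock α unitDims))
      (PowerSeries.C (3 / 16) + PowerSeries.X * (8 + 64 * PowerSeries.X)⁻¹) (1 / 32) := by
  have lin : ∀ r t : ℝ, Expands α (HahnSeries.C r + HahnSeries.C t * smallV α)
      (PowerSeries.C r) t := fun r t => by
    simpa using (Expands.const r).add ((Expands.const t).mul h0 h1 Expands.smallV)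
  have hs := Expands.smallS h1
  -- At `d = 1`, `e = 0` the squared vertex is `(1 - v)²` and the norm is `(4 + 2v)(2 + v + s(16 -
  -- 10v))`. This term carries a factor `s`, so `b` comes only from `(3 + 2v)/(16 + 8v)`.
  have hv := (lin 1 (-1)).mul h0 h1 (lin 1 (-1))
  have hn := (lin 4 2).mul h0 h1 ((lin 2 1).add (hs.mul h0 h1 (lin 16 (-10))))
  have h2 := ((lin 3 2).div h0 h1 (lin 16 8) (by simp)).add
    ((hs.mul h0 h1 hv).div h0 h1 hn (by simp))
  have hnd := nondegenerate h0 h1 (one_ne_zero (α := ℝ))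
  have h3 := mul_coeff_two_log_block (e := HahnSeries.C 0) (smallV_ne_zero α) (smallS_ne_zero α) hnd
  rw [logBlock_eq]
  change Expands α (smallV α * PowerSeries.coeff 2 (PowerSeries.logOf
    (block (smallV α * smallS α)⁻¹ (HahnSeries.C 0 / smallV α) (HahnSeries.C 1 / smallV α)))) _ _
  have hx := h3.trans (congrArg₂ (· + ·)
    (congrArg₂ (· / ·) (?_ : _ = HahnSeries.C 3 + HahnSeries.C 2 * smallV α)
      (?_ : _ = HahnSeries.C 16 + HahnSeries.C 8 * smallV α))
    (congrArg₂ (· / ·)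
      (?_ : _ = smallS α * ((HahnSeries.C 1 + HahnSeries.C (-1) * smallV α) *
        (HahnSeries.C 1 + HahnSeries.C (-1) * smallV α)))
      (?_ : _ = (HahnSeries.C 4 + HahnSeries.C 2 * smallV α) *
        ((HahnSeries.C 2 + HahnSeries.C 1 * smallV α) +
          smallS α * (HahnSeries.C 16 + HahnSeries.C (-10) * smallV α)))))
  · have ha : (PowerSeries.C 3 * (PowerSeries.C 16)⁻¹ + PowerSeries.X *
        (PowerSeries.C 1 * PowerSeries.C 1) * (PowerSeries.C 4 * (PowerSeries.C 2 +
          PowerSeries.X * PowerSeries.C 16))⁻¹ : PowerSeries ℝ) =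
        PowerSeries.C (3 / 16) + PowerSeries.X * (8 + 64 * PowerSeries.X)⁻¹ := by
      rw [PowerSeries.C_inv, ← map_mul, div_eq_mul_inv, map_one, mul_one, mul_one]
      congr 3
      simp only [map_ofNat]
      ring
    rw [hx]
    rw [ha] at h2
    refine Eq.mp (congrArg (Expands α _ _) ?_) h2
    simp
    norm_num
  all_goals
    simp only [scaledVertexTwo, scaledNormTwo, map_neg, map_ofNat, map_one, map_zero]
    ring

theorem coeff_unitSeries (k : ℕ) : PowerSeries.coeff (k + 1)
    (PowerSeries.C (3 / 16) + PowerSeries.X * (8 + 64 * PowerSeries.X)⁻¹ : PowerSeries ℝ) =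
      (-8) ^ k / 8 := by
  have h8 : (8 + 64 * PowerSeries.X : PowerSeries ℝ) =
      PowerSeries.C 8 + PowerSeries.C 64 * PowerSeries.X := by
    rw [map_ofNat, map_ofNat]
  have h2 : (8 + 64 * PowerSeries.X : PowerSeries ℝ)⁻¹ =
      PowerSeries.mk fun k => (-8) ^ k / 8 := by
    rw [PowerSeries.inv_eq_iff_mul_eq_one (by simp [h8]), h8]
    ext n
    cases n with
    | zero => simp
    | succ n =>
      rw [mul_add, ← mul_assoc, map_add, PowerSeries.coeff_mul_C, PowerSeries.coeff_succ_mul_X,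
        PowerSeries.coeff_mul_C, PowerSeries.coeff_mk, PowerSeries.coeff_mk,
        PowerSeries.coeff_one, if_neg n.succ_ne_zero]
      ring
  rw [h2, map_add, PowerSeries.coeff_succ_X_mul, PowerSeries.coeff_mk, PowerSeries.coeff_C,
    if_neg k.succ_ne_zero, zero_add]

theorem coeff_zero_unitSeries : PowerSeries.coeff 0
    (PowerSeries.C (3 / 16) + PowerSeries.X * (8 + 64 * PowerSeries.X)⁻¹ : PowerSeries ℝ) =
      3 / 16 := by
  simp

theorem coeff_two_f_unitDims (α x : ℚ) : (f α x unitDims).coeff 2 =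
    cCoeff x (PowerSeries.coeff 2 (logBlock α unitDims)) := by
  rw [coeff_f, if_pos (by norm_num)]

theorem coeff_f_regular {M : ℕ} (hM : 1 ≤ M) (hα : α ∈ regular M) :
    (f α 0 unitDims).coeff 2 = 1 / 32 := by
  have hα' := regular_subset_halfOpen M hα
  have h1 := lt_one_of_mem_halfOpen hα'
  rw [coeff_two_f_unitDims]
  exact cCoeff_zero_of_ne h1 (expands_unitDims (pos_of_mem_halfOpen hM hα') h1)
    fun k => expo_ne_zero_of_mem_regular hM hα (k + 1)

theorem coeff_f_exceptional {M : ℕ} (hM : 1 ≤ M) :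
    (f (exceptional M) 0 unitDims).coeff 2 = (-8) ^ (M - 1) / 8 + 1 / 32 := by
  have hα := exceptional_mem_halfOpen hM
  have h1 := lt_one_of_mem_halfOpen hα
  rw [coeff_two_f_unitDims, cCoeff_zero_of_eq h1
    (expands_unitDims (pos_of_mem_halfOpen hM hα) h1) (expo_exceptional M)]
  obtain ⟨k, rfl⟩ := Nat.exists_eq_add_of_le' hM
  rw [coeff_unitSeries, Nat.add_sub_cancel]

theorem f_expo_ne_zero {M m : ℕ} (hM : 1 ≤ M) (hα : α ∈ halfOpen M) (hm : m ∈ Finset.Icc 1 M) :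
    f α (expo m α) ≠ 0 := by
  intro h
  have h1 := lt_one_of_mem_halfOpen hα
  obtain ⟨hm1, hmM⟩ := Finset.mem_Icc.1 hm
  obtain ⟨k, rfl⟩ := Nat.exists_eq_add_of_le' hm1
  have h2 := coeff_two_f_unitDims α (expo (k + 1) α)
  rw [h, cCoeff_expo h1 (expands_unitDims (pos_of_mem_halfOpen hM hα) h1)
    ((expo_pos_iff hM hα _).2 hmM), Pi.zero_apply, Polynomial.coeff_zero] at h2
  cases k with
  | zero =>
    rw [coeff_zero_unitSeries] at h2
    norm_num at h2
  | succ k =>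
    rw [coeff_unitSeries] at h2
    exact div_ne_zero (pow_ne_zero k (by norm_num)) (by norm_num) h2.symm

theorem f_zero_ne_zero {M : ℕ} (hM : 1 ≤ M) (hα : α ∈ halfOpen M) : f α 0 ≠ 0 := by
  intro h
  rcases hα.2.lt_or_eq with h2 | h2
  · have h3 := coeff_f_regular hM ⟨hα.1, h2⟩
    rw [h] at h3
    norm_num at h3
  · have h3 := coeff_f_exceptional hM
    rw [exceptional, ← h2, h, Pi.zero_apply, Polynomial.coeff_zero] at h3
    -- Vanishing of `(-8)^(M-1)/8 + 1/32` becomes an equation in integers, impossible modulo 4.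
    have h4 : (4 : ℤ) * (-8) ^ (M - 1) = -1 := by
      have : (4 : ℝ) * (-8) ^ (M - 1) = -1 := by linarith
      exact_mod_cast this
    omega

theorem f_expo_congr {M M' m : ℕ} {α' : ℚ} (hM : 1 ≤ M) (hM' : 1 ≤ M') (hα : α ∈ halfOpen M)
    (hα' : α' ∈ halfOpen M') (hm : m ∈ Finset.Icc 1 (min M M')) :
    f α (expo m α) = f α' (expo m α') := by
  obtain ⟨hm1, hmM⟩ := Finset.mem_Icc.1 hm
  obtain ⟨k, rfl⟩ := Nat.exists_eq_add_of_le' hm1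
  have h1 := lt_one_of_mem_halfOpen hα
  have h1' := lt_one_of_mem_halfOpen hα'
  refine f_congr fun p n hn => ?_
  obtain ⟨a, b, h⟩ := exists_expands p n hn
  rw [cCoeff_expo h1 (h α (pos_of_mem_halfOpen hM hα) h1)
      ((expo_pos_iff hM hα _).2 (hmM.trans (min_le_left _ _))),
    cCoeff_expo h1' (h α' (pos_of_mem_halfOpen hM' hα') h1')
      ((expo_pos_iff hM' hα' _).2 (hmM.trans (min_le_right _ _)))]

theorem f_zero_congr {M M' : ℕ} {α' : ℚ} (hM : 1 ≤ M) (hM' : 1 ≤ M') (hα : α ∈ regular M)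
    (hα' : α' ∈ regular M') : f α 0 = f α' 0 := by
  have hh := regular_subset_halfOpen M hα
  have hh' := regular_subset_halfOpen M' hα'
  have h1 := lt_one_of_mem_halfOpen hh
  have h1' := lt_one_of_mem_halfOpen hh'
  refine f_congr fun p n hn => ?_
  obtain ⟨a, b, h⟩ := exists_expands p n hn
  rw [cCoeff_zero_of_ne h1 (h α (pos_of_mem_halfOpen hM hh) h1)
      fun k => expo_ne_zero_of_mem_regular hM hα (k + 1),
    cCoeff_zero_of_ne h1' (h α' (pos_of_mem_halfOpen hM' hh') h1')
      fun k => expo_ne_zero_of_mem_regular hM' hα' (k + 1)]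

end UnitDimension

end PrincipalPart

end VirasoroBlock

end

open VirasoroBlock in
theorem proposition1 :
    -- the form of the principal part, with coefficient functions none of which vanishes identically
    (∀ M : ℕ, 1 ≤ M → ∀ α ∈ halfOpen M,
      (∀ p : ClassicalDims,
        prinLogBlock α p =
          (∑ m ∈ Finset.Icc 1 M,
            Polynomial.C (cMonomial (expo m α) 1) *
              (f α (expo m α) p).map (HahnSeries.C : ℝ →+* LargeC))
          + (f α 0 p).map (HahnSeries.C : ℝ →+* LargeC)) ∧
      (∀ m ∈ Finset.Icc 1 M, f α (expo m α) ≠ 0) ∧ f α 0 ≠ 0) ∧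
    -- the coefficients of non-zero powers do not depend on `α`
    (∀ M M' : ℕ, 1 ≤ M → 1 ≤ M' → ∀ α ∈ halfOpen M, ∀ α' ∈ halfOpen M',
      ∀ m ∈ Finset.Icc 1 (min M M'), f α (expo m α) = f α' (expo m α')) ∧
    -- the constant term is the same at all regular points
    (∀ M M' : ℕ, 1 ≤ M → 1 ≤ M' → ∀ α ∈ regular M, ∀ α' ∈ regular M', f α 0 = f α' 0) ∧
    -- at the exceptional points it takes pairwise different values, different from the regular one
    (∀ M M' : ℕ, 1 ≤ M → 1 ≤ M' → M ≠ M' → f (exceptional M) 0 ≠ f (exceptional M') 0) ∧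
    (∀ M M' : ℕ, 1 ≤ M → 1 ≤ M' → ∀ α ∈ regular M', f (exceptional M) 0 ≠ f α 0) := by
  refine ⟨fun M hM α hα => ⟨prinLogBlock_eq hM hα, fun m => f_expo_ne_zero hM hα,
    f_zero_ne_zero hM hα⟩, fun M M' hM hM' α hα α' hα' m => f_expo_congr hM hM' hα hα',
    fun M M' hM hM' α hα α' hα' => f_zero_congr hM hM' hα hα', ?_, ?_⟩
  · intro M M' hM hM' hne h
    have h2 := coeff_f_exceptional hM
    rw [h, coeff_f_exceptional hM'] at h2
    have h3 : (-8 : ℝ) ^ (M' - 1) = (-8) ^ (M - 1) := by linarith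
    -- Absolute values remove the alternating sign, and injectivity of `8^k` compares `M - 1` with
    -- `M' - 1`. The truncated subtraction is harmless since both indices are at least 1.
    have h4 := congrArg abs h3
    rw [abs_pow, abs_pow, abs_neg, abs_of_pos (by norm_num)] at h4
    have h5 := pow_right_injective₀ (by norm_num) (by norm_num) h4
    omega
  · intro M M' hM hM' α hα h
    have h2 := coeff_f_exceptional hM
    rw [h, coeff_f_regular hM' hα] at h2
    have h3 : (-8 : ℝ) ^ (M - 1) ≠ 0 := pow_ne_zero _ (by norm_num)
    exact h3 (by linarith)
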